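/- Let $n\ge 0$ be an integer, let $\sigma,\delta\in\{1,-1\}$, let $I$ be the $2(n+1)\times 2(n+1)$ identity matrix, and let $*$ denote complex conjugation (entrywise for vectors and matrices, without transposition). **The hierarchy.** On differential polynomials in two functions $q,r$ of $x$ (polynomials in $q,r$ and their $x$-derivatives) let $\partial_x$ be the total derivative, let $\partial_x^{-1}$ denote the primitive without constant term, and put $$K_m=\begin{pmatrix}K_{1,m}\\K_{2,m}\end{pmatrix}=L^m\begin{pmatrix}-q\\ r\end{pmatrix},\qquad L=\begin{pmatrix}-\partial_x+2q\,\partial_x^{-1}r & 2q\,\partial_x^{-1}q\\ -2r\,\partial_x^{-1}r & \partial_x-2r\,\partial_x^{-1}q\end{pmatrix}$$ (the two primitives in each row are taken together, as $\partial_x^{-1}$ of a sum; these primitives exist). The NLS(I) hierarchy for a complex function $q(x,t)$ of $x\in\mathbb R$ and the real times $t=(t_2,t_4,t_6,\dots)$ is $$i\,q_{t_{2l}}=-K_{1,2l}\big|_{r(x,t)=\delta q^*(\sigma x,t)},\qquad l=1,2,\dots$$ **Double Wronskians.** For column vectors $\varphi,\psi$ of length $2(n+1)$, $\widehat\varphi^{(s)}$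 stands for the columns $\varphi,\partial_x\varphi,\dots,\partial_x^s\varphi$ (no column if $s=-1$), and $|\widehat\varphi^{(s)};\widehat\psi^{(s')}|$, $s+s'=2n$, is the determinant of the matrix with the columns $\widehat\varphi^{(s)}$ followed by the columns $\widehat\psi^{(s')}$. Put $$f=|\widehat\varphi^{(n)};\widehat\psi^{(n)}|,\qquad q=\frac{2\,|\widehat\varphi^{(n-1)};\widehat\psi^{(n+1)}|}{|\widehat\varphi^{(n)};\widehat\psi^{(n)}|}.$$ That $q$ given in this way solves the NLS(I) hierarchy at $t$ means: at every $x$ with $f(x,t)\neq 0$, the functions $q(\cdot,t)$ and $\delta q^*(\sigma\,\cdot,t)$ are smooth at $x$, all derivatives $q_{t_{2l}}(x,t)$ exist, and all equations of the hierarchy hold at $(x,t)$. **Theorem.** (1) Let $A,T\in\mathbb C^{2(n+1)\times 2(n+1)}$ and $C^{\pm}\in\mathbb C^{2(n+1)}$ satisfy $$AT+\sigma TA^*=0,\qquad TT^*=\delta\sigma I,\qquad C^-=TC^{+*},$$ and let $$\varphi=\exp\Big(\tfrac12Ax+\tfrac i2\sum_{j\ge1}A^{2j}t_{2j}\Big)C^+,\qquad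 \psi=\exp\Big(-\tfrac12Ax-\tfrac i2\sum_{j\ge1}A^{2j}t_{2j}\Big)C^-.$$ Then, at all times $t$ for which the series converges absolutely (in particular whenever only finitely many $t_{2j}$ are nonzero), $\psi(x,t)=T\varphi^*(\sigma x,t)$ for all $x\in\mathbb R$, and $q$ solves the NLS(I) hierarchy. (2) For every $\mathbf K\in\mathbb C^{(n+1)\times(n+1)}$ the block matrices $$T=\begin{pmatrix}0&T_2\\ \mathbf I&0\end{pmatrix},\qquad A=\begin{pmatrix}\mathbf K&0\\0&K_4\end{pmatrix}$$ with $T_2=-\mathbf I$ for $(\sigma,\delta)=(1,-1),(-1,1)$, $T_2=\mathbf I$ for $(\sigma,\delta)=(1,1),(-1,-1)$, $K_4=-\mathbf K^*$ for $\sigma=1$ and $K_4=\mathbf K^*$ for $\sigma=-1$, satisfy $AT+\sigma TA^*=0$ and $TT^*=\delta\sigma I$. (3) In (1), with $T$ and $A$ as in (2), $\varphi$ can be chosen as follows, where $\theta(k)=\frac12kx+\frac i2\sum_{j\ge1}k^{2j}t_{2j}$. (a) $\mathbf K=\mathrm{Diag}(k_1,\dots,k_{n+1})$: for arbitrary $k_l,c_l,d_l\in\mathbb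 C$, $$\varphi=\big(c_1e^{\theta(k_1)},\dots,c_{n+1}e^{\theta(k_{n+1})},\,d_1e^{\theta(-\sigma k_1^*)},\dots,d_{n+1}e^{\theta(-\sigma k_{n+1}^*)}\big)^T,$$ at all $t$ for which the series in all the $\theta(k_l)$ converge absolutely. (b) $\mathbf K$ is the lower triangular Jordan block of size $n+1$ with $k\in\mathbb C$ on the diagonal and $1$ on the subdiagonal: for $c$ and $d$ constants or, more generally, functions $c=c(k)$, $d=d(k^*)$ analytic at $k$ and $k^*$ respectively, $\varphi$ has the entries $$\frac{\partial_k^s}{s!}\big(c\,e^{\theta(k)}\big),\ s=0,\dots,n,\quad\text{followed by}\quad \frac{\partial_{k^*}^s}{s!}\big(d\,e^{\theta(-\sigma k^*)}\big),\ s=0,\dots,n$$ ($k^*$ being treated as an independent complex variable in the latter derivatives), at all $t$ for which $\sum_j\rho^{2j}t_{2j}$ converges for some $\rho>|k|$. In both cases $\varphi$ is the function $\varphi$ of (1) for a vector $C^+$: $C^+=(c_1,\dots,c_{n+1},d_1,\dots,d_{n+1})^T$ in (a), and in (b) $C^+$ has the entries $c^{(s)}(k)/s!$, $s=0,\dots,n$,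 followed by $d^{(s)}(k^*)/s!$, $s=0,\dots,n$; and with $\psi(x,t)=T\varphi^*(\sigma x,t)$ the function $q$ solves the NLS(I) hierarchy. -/

import Mathlib

open scoped ComplexConjugate ContDiff
open MvPolynomial (X C)

namespace AKNS

/-! ### Differential polynomials and the AKNS hierarchy -/

/-- Differential polynomials in two functions `q`, `r` of `x`: the variable `(0, j)` stands for
`∂ₓʲ q` and the variable `(1, j)` stands for `∂ₓʲ r`. -/
abbrev DiffPoly : Type := MvPolynomial (Fin 2 × ℕ) ℂ

/-- The variable `q`. -/
noncomputable def qv : DiffPoly := X (0, 0)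

/-- The variable `r`. -/
noncomputable def rv : DiffPoly := X (1, 0)

/-- The total `x`-derivative `∂ₓ` on differential polynomials. -/
noncomputable def D : Derivation ℂ DiffPoly DiffPoly :=
  MvPolynomial.mkDerivation ℂ fun v => X (v.1, v.2 + 1)

open Classical in
/-- The inverse `∂ₓ⁻¹` on differential polynomials: the primitive without constant term (it is
unique, see `primitive_unique`). It is only meaningful on total `x`-derivatives, and it is only
applied to total `x`-derivatives in the hierarchy, see `D_Dinv_hierarchy`. -/
noncomputable def Dinv (p : DiffPoly) : DiffPoly :=
  if h : ∃ u, D u = p ∧ MvPolynomial.constantCoeff u = 0 then h.choose else 0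

/-- The recursion operator
`L = [[-∂ₓ + 2 q ∂ₓ⁻¹ r, 2 q ∂ₓ⁻¹ q], [-2 r ∂ₓ⁻¹ r, ∂ₓ - 2 r ∂ₓ⁻¹ q]]`
applied to a column of two differential polynomials; the two occurrences of `∂ₓ⁻¹` in each row are
taken together, as `∂ₓ⁻¹ (r a + q b)`. -/
noncomputable def L (K : DiffPoly × DiffPoly) : DiffPoly × DiffPoly :=
  (-D K.1 + 2 * qv * Dinv (rv * K.1 + qv * K.2), D K.2 - 2 * rv * Dinv (rv * K.1 + qv * K.2))

/-- The right-hand sides `K_n = Lⁿ (-q, r)ᵀ` of the AKNS hierarchy `(q, r)ᵀ_{t_n} = K_n`. -/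
noncomputable def K (n : ℕ) : DiffPoly × DiffPoly := L^[n] (-qv, rv)

/-- The value at `x` of a differential polynomial on two functions `u` (for `q`) and `v`
(for `r`). -/
noncomputable def evalAt (p : DiffPoly) (u v : ℝ → ℂ) (x : ℝ) : ℂ :=
  MvPolynomial.eval (fun w => iteratedDeriv w.2 (if w.1 = 0 then u else v) x) p

/-! ### The primitive `∂ₓ⁻¹` is well defined on the hierarchy -/

theorem pderiv_D (i : Fin 2) (j : ℕ) (p : DiffPoly) :
    MvPolynomial.pderiv (i, j + 1) (D p) =
      D (MvPolynomial.pderiv (i, j + 1) p) + MvPolynomial.pderiv (i, j) p := by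
  have h : ⁅MvPolynomial.pderiv (R := ℂ) ((i, j + 1) : Fin 2 × ℕ), D⁆ =
      MvPolynomial.pderiv (i, j) := by
    refine MvPolynomial.derivation_ext fun v => ?_
    rw [Derivation.commutator_apply]
    obtain ⟨a, b⟩ := v
    simp only [D, MvPolynomial.mkDerivation_X, MvPolynomial.pderiv_X]
    by_cases hab : a = i ∧ b = j
    · obtain ⟨rfl, rfl⟩ := hab
      simp
    · by_cases hb : a = i ∧ b = j + 1
      · obtain ⟨rfl, rfl⟩ := hb
        simp
      · simp [hab, hb]
  have h2 := congrArg (fun E : Derivation ℂ DiffPoly DiffPoly => E p) h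
  simp only [Derivation.commutator_apply] at h2
  rw [← h2]; ring

/-- A differential polynomial has at most one primitive without constant term. -/
theorem primitive_unique {u v : DiffPoly} (h : D u = D v)
    (hc : MvPolynomial.constantCoeff u = MvPolynomial.constantCoeff v) : u = v := by
  set w := u - v with hw
  have hD : D w = 0 := by simp [hw, h]
  have hz : ∀ (m : ℕ) (i : Fin 2) (j : ℕ), (∀ k, j + m ≤ k → (i, k) ∉ w.vars) →
      MvPolynomial.pderiv (i, j) w = 0 := by
    intro m
    induction m with
    | zero => intro i j hj; exact MvPolynomial.pderiv_eq_zero_of_notMem_vars (hj j le_rfl)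
    | succ m ih =>
      intro i j hj
      have h1 := ih i (j + 1) fun k hk => hj k (by omega)
      have h2 := pderiv_D i j w
      rw [hD, h1] at h2
      simpa using h2.symm
  have hp : ∀ v, MvPolynomial.pderiv v w = 0 := by
    rintro ⟨i, j⟩
    refine hz (w.vars.sup Prod.snd + 1) i j fun k hk hmem => ?_
    have := Finset.le_sup (f := Prod.snd) hmem
    simp only at this
    omega
  refine sub_eq_zero.mp (?_ : w = 0)
  ext m
  by_cases hm : m = 0
  · subst hm
    have : MvPolynomial.constantCoeff w = 0 := by simp [hw, hc]
    simpa [MvPolynomial.constantCoeff_eq] using this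
  · obtain ⟨v, hv⟩ := Finsupp.ne_iff.mp hm
    have h1 := MvPolynomial.coeff_pderiv (i := v) w (m - Finsupp.single v 1)
    have h2 : m - Finsupp.single v 1 + Finsupp.single v 1 = m :=
      tsub_add_cancel_of_le (by
        rw [Finsupp.single_le_iff]
        exact Nat.one_le_iff_ne_zero.mpr (by simpa using hv))
    rw [hp, h2, MvPolynomial.coeff_zero] at h1
    rcases mul_eq_zero.mp h1.symm with h3 | h3
    · simpa using h3
    · exact absurd h3 (Nat.cast_add_one_ne_zero _)

theorem D_Dinv {p : DiffPoly} (h : ∃ u, D u = p) :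
    D (Dinv p) = p ∧ MvPolynomial.constantCoeff (Dinv p) = 0 := by
  obtain ⟨u, hu⟩ := h
  have h' : ∃ u, D u = p ∧ MvPolynomial.constantCoeff u = 0 :=
    ⟨u - C (MvPolynomial.constantCoeff u), by
      rw [map_sub, hu]; simp [D], by simp⟩
  rw [Dinv, dif_pos h']
  exact h'.choose_spec

/-- All primitives needed in the AKNS hierarchy exist. -/
theorem D_Dinv_hierarchy (n : ℕ) :
    D (Dinv (rv * (K n).1 + qv * (K n).2)) = rv * (K n).1 + qv * (K n).2 := by
  induction n using Nat.strong_induction_on with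
  | _ n ih =>
    refine (D_Dinv ?_).1
    set a : ℕ → DiffPoly := fun i => (K i).1 with ha
    set b : ℕ → DiffPoly := fun i => (K i).2 with hb
    set w : ℕ → DiffPoly := fun i => Dinv (rv * (K i).1 + qv * (K i).2) with hw
    have hK : ∀ i, K (i + 1) = L (K i) := fun i => Function.iterate_succ_apply' _ _ _
    have hDa : ∀ i, D (a i) = 2 * qv * w i - a (i + 1) := fun i => by
      simp only [ha, hw, hK i, L]; ring
    have hDb : ∀ i, D (b i) = b (i + 1) + 2 * rv * w i := fun i => by
      simp only [hb, hw, hK i, L]; ring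
    have hDw : ∀ i < n, D (w i) = rv * a i + qv * b i := fun i hi => ih i hi
    refine ⟨∑ i ∈ Finset.range n, (w i * w (n - 1 - i) - a i * b (n - 1 - i)), ?_⟩
    have hterm : ∀ i ∈ Finset.range n,
        D (w i * w (n - 1 - i) - a i * b (n - 1 - i)) =
          (rv * w i * a (n - 1 - i) + qv * b i * w (n - 1 - i))
          - (rv * a i * w (n - 1 - i) + qv * w i * b (n - 1 - i))
          + (a (i + 1) * b (n - (i + 1)) - a i * b (n - i)) := by
      intro i hi
      have hi' := Finset.mem_range.mp hi
      have e1 : n - (i + 1) = n - 1 - i := by omega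
      have e2 : n - i = n - 1 - i + 1 := by omega
      rw [e1, e2]
      simp only [map_sub, Derivation.leibniz, smul_eq_mul]
      rw [hDw i hi', hDw (n - 1 - i) (by omega), hDa, hDb]
      ring
    rw [map_sum, Finset.sum_congr rfl hterm, Finset.sum_add_distrib, Finset.sum_sub_distrib,
      Finset.sum_range_sub (fun i => a i * b (n - i))]
    have hrefl : ∑ i ∈ Finset.range n, (rv * w i * a (n - 1 - i) + qv * b i * w (n - 1 - i)) =
        ∑ i ∈ Finset.range n, (rv * a i * w (n - 1 - i) + qv * w i * b (n - 1 - i)) := by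
      rw [← Finset.sum_range_reflect]
      refine Finset.sum_congr rfl fun i hi => ?_
      have hi' := Finset.mem_range.mp hi
      have e : n - 1 - (n - 1 - i) = i := by omega
      rw [e]; ring
    have ha0 : a 0 = -qv := rfl
    have hb0 : b 0 = rv := rfl
    rw [hrefl, ha0, Nat.sub_self, hb0]
    simp only [ha, hb, Nat.sub_zero]
    ring

/-! ### The local and nonlocal NLS(I) hierarchy -/

/-- The times `t_2, t_4, t_6, …` of the even flows: the entry `t j` is `t_{2(j+1)}`. -/
abbrev Times : Type := ℕ → ℝ

/-- The potential `r(x,t) = δ q*(σ x, t)` of the reduction. -/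
noncomputable def reducedR (σ δ : ℝ) (q : ℝ → Times → ℂ) (x : ℝ) (t : Times) : ℂ :=
  δ * conj (q (σ * x) t)

/-- `q` satisfies at the point `(x, t)` all equations of the NLS(I) hierarchy
`i q_{t_{2l}} = -K_{1,2l}`, `l = 1, 2, …`, where `r(x,t) = δ q*(σ x, t)` is inserted in `K_{1,2l}`
(here `l = j + 1`). The functions `q` and `r` are smooth in the space variable at `x`, and
the derivative `q_{t_{2l}}` exists. -/
def SolvesNLSI (σ δ : ℝ) (q : ℝ → Times → ℂ) (x : ℝ) (t : Times) : Prop :=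
  ContDiffAt ℝ ∞ (fun y => q y t) x ∧ ContDiffAt ℝ ∞ (fun y => reducedR σ δ q y t) x ∧
    ∀ j : ℕ, ∃ q' : ℂ,
      HasDerivAt (fun s => q x (Function.update t j s)) q' (t j) ∧
        Complex.I * q' =
          -evalAt (K (2 * (j + 1))).1 (fun y => q y t) (fun y => reducedR σ δ q y t) x

/-! ### Double Wronskians -/

/-- Rows and columns of a matrix of size `2 (n + 1)`, in two blocks of size `n + 1`. -/
abbrev Idx (n : ℕ) : Type := Fin (n + 1) ⊕ Fin (n + 1)

/-- The position `0, 1, …, 2n + 1` of a row or column. -/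
def Idx.pos {n : ℕ} (c : Idx n) : ℕ := (finSumFinEquiv c : Fin (n + 1 + (n + 1)))

/-- Entrywise complex conjugate of a vector. -/
noncomputable def conjVec {n : ℕ} (v : Idx n → ℂ) : Idx n → ℂ := fun i => conj (v i)

/-- Entrywise complex conjugate (without transposition) of a matrix. -/
noncomputable def conjMat {ι : Type} (M : Matrix ι ι ℂ) : Matrix ι ι ℂ := M.map fun z => conj z

/-- The double Wronskian with `p` columns `φ, ∂ₓφ, …, ∂ₓ^{p-1}φ` followed by the `2n + 2 - p`
columns `ψ, ∂ₓψ, …`. -/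
noncomputable def doubleWronskian (n p : ℕ) (φ ψ : ℝ → Idx n → ℂ) (x : ℝ) : ℂ :=
  Matrix.det (Matrix.of fun i c : Idx n =>
    if c.pos < p then iteratedDeriv c.pos (fun y => φ y i) x
    else iteratedDeriv (c.pos - p) (fun y => ψ y i) x)

/-- The denominator `|φ̂^{(n)}; ψ̂^{(n)}|`. -/
noncomputable def tauF {n : ℕ} (φ ψ : ℝ → Times → Idx n → ℂ) (x : ℝ) (t : Times) : ℂ :=
  doubleWronskian n (n + 1) (fun y => φ y t) (fun y => ψ y t) x

/-- `q = 2 |φ̂^{(n-1)}; ψ̂^{(n+1)}| / |φ̂^{(n)}; ψ̂^{(n)}|`. -/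
noncomputable def wronskianQ {n : ℕ} (φ ψ : ℝ → Times → Idx n → ℂ) (x : ℝ) (t : Times) : ℂ :=
  2 * doubleWronskian n n (fun y => φ y t) (fun y => ψ y t) x / tauF φ ψ x t

/-- The terms `A^{2j} t_{2j}`, `j = 1, 2, …`. -/
noncomputable def timeTerm {n : ℕ} (A : Matrix (Idx n) (Idx n) ℂ) (t : Times) (j : ℕ) :
    Matrix (Idx n) (Idx n) ℂ :=
  (t j : ℂ) • A ^ (2 * (j + 1))

/-- The exponent `½ A x + (i/2) ∑ A^{2j} t_{2j}` (the substitution `t → i t` is made). -/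
noncomputable def exponent {n : ℕ} (A : Matrix (Idx n) (Idx n) ℂ) (x : ℝ) (t : Times) :
    Matrix (Idx n) (Idx n) ℂ :=
  ((x : ℂ) / 2) • A + (Complex.I / 2) • ∑' j, timeTerm A t j

/-- `φ = exp(½ A x + (i/2) ∑ A^{2j} t_{2j}) C⁺`. -/
noncomputable def phi {n : ℕ} (A : Matrix (Idx n) (Idx n) ℂ) (Cp : Idx n → ℂ)
    (x : ℝ) (t : Times) : Idx n → ℂ :=
  (NormedSpace.exp (exponent A x t)).mulVec Cp

/-- `ψ = exp(-½ A x - (i/2) ∑ A^{2j} t_{2j}) C⁻`. -/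
noncomputable def psi {n : ℕ} (A : Matrix (Idx n) (Idx n) ℂ) (Cm : Idx n → ℂ)
    (x : ℝ) (t : Times) : Idx n → ℂ :=
  (NormedSpace.exp (-exponent A x t)).mulVec Cm

/-- The vector `T φ*(σ x, t)`. -/
noncomputable def reflected {n : ℕ} (σ : ℝ) (T : Matrix (Idx n) (Idx n) ℂ)
    (φ : ℝ → Times → Idx n → ℂ) (x : ℝ) (t : Times) : Idx n → ℂ :=
  T.mulVec (conjVec (φ (σ * x) t))

/-! ### The explicit choices of `T`, `A` and `φ` -/

/-- `A T + σ T A* = 0` and `T T* = δ σ I`. -/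
def Compatible {n : ℕ} (σ δ : ℝ) (A T : Matrix (Idx n) (Idx n) ℂ) : Prop :=
  A * T + (σ : ℂ) • (T * conjMat A) = 0 ∧
    T * conjMat T = ((δ * σ : ℝ) : ℂ) • (1 : Matrix (Idx n) (Idx n) ℂ)

/-- The block matrix `T` with `T₁ = T₄ = 0`, `T₃ = I` and `T₂ = -I` if `(σ, δ)` is `(1, -1)` or
`(-1, 1)`, `T₂ = I` if `(σ, δ)` is `(1, 1)` or `(-1, -1)`. -/
noncomputable def tableT (n : ℕ) (σ δ : ℝ) : Matrix (Idx n) (Idx n) ℂ :=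
  Matrix.fromBlocks 0 (if σ = δ then 1 else -1) 1 0

/-- The block diagonal matrix `A` with `K₁ = M` and `K₄ = -M*` if `σ = 1`, `K₄ = M*` if
`σ = -1`. -/
noncomputable def tableA {n : ℕ} (σ : ℝ) (M : Matrix (Fin (n + 1)) (Fin (n + 1)) ℂ) :
    Matrix (Idx n) (Idx n) ℂ :=
  Matrix.fromBlocks M 0 0 (if σ = 1 then -conjMat M else conjMat M)

/-- `θ(k) = ½ k x + (i/2) ∑ k^{2j} t_{2j}`. -/
noncomputable def theta (k : ℂ) (x : ℝ) (t : Times) : ℂ :=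
  k * x / 2 + Complex.I / 2 * ∑' j, k ^ (2 * (j + 1)) * (t j : ℂ)

/-- The lower triangular Jordan matrix `J_{n+1}(k)`. -/
def jordan (n : ℕ) (k : ℂ) : Matrix (Fin (n + 1)) (Fin (n + 1)) ℂ :=
  Matrix.of fun i j => if i = j then k else if (i : ℕ) = j + 1 then 1 else 0

/-- The vector `φ` with entries `c_l e^{θ(k_l)}` followed by `d_l e^{θ(-k_l*)}` for `σ = 1`, by
`d_l e^{θ(k_l*)}` for `σ = -1`. -/
noncomputable def phiDiag {n : ℕ} (σ : ℝ) (k c d : Fin (n + 1) → ℂ) (x : ℝ) (t : Times) :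
    Idx n → ℂ :=
  Sum.elim (fun l => c l * Complex.exp (theta (k l) x t))
    (fun l => d l * Complex.exp (theta (if σ = 1 then -conj (k l) else conj (k l)) x t))

/-- The vector of the `f^{(s)}(z) / s!`, `s = 0, …, n`. -/
noncomputable def taylor (n : ℕ) (f : ℂ → ℂ) (z : ℂ) : Fin (n + 1) → ℂ :=
  fun s => iteratedDeriv s f z / (Nat.factorial s : ℂ)

/-- The vector `φ` with entries `∂_k^s (c e^{θ(k)}) / s!` followed by
`∂_{k*}^s (d e^{θ(-k*)}) / s!` for `σ = 1`, by `∂_{k*}^s (d e^{θ(k*)}) / s!` for `σ = -1`,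
`s = 0, …, n`; here `c` and `d` are functions of `k` and `k*`. -/
noncomputable def phiJordan (n : ℕ) (σ : ℝ) (k : ℂ) (c d : ℂ → ℂ) (x : ℝ) (t : Times) :
    Idx n → ℂ :=
  Sum.elim (taylor n (fun z => c z * Complex.exp (theta z x t)) k)
    (taylor n (fun w => d w * Complex.exp (theta (if σ = 1 then -w else w) x t)) (conj k))

end AKNS

/-! Collect φ, Aφ, …, Aⁿφ, ψ, Aψ, …, Aⁿψ as the columns of a matrix B and put Z = B diag(I, -I) B⁻¹.
Multiplication by A shifts the columns inside each block, so in the basis B only the two end columns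
contribute to AZ - ZA. Hence AZ - ZA = W l with W of two columns and l of two rows
(`commutator_eq`). The 2×2 moments m_j = l Aʲ W are the coefficients of the dressed Pauli matrix
S(λ) = `pauli` + Σ m_j λ^{-j-1}. The commutator relation gives S² = 1
(`anticommutator_of_realization`) and, since Bₓ = ½ A B diag(I, -I), the Lax equation Sₓ = -½ [λ
`pauli` + m₀, S] (`flow_of_realization`, `hasDerivAt_moment_space`).

The off-diagonal part of the Lax equation is the recursion of the hierarchy, with the diagonal
moments in the place of the primitives. No integration constant has to be chosen: S² = 1 expresses
each diagonal moment quadratically through earlier moments (`moment_diag`), and ∂ₓ⁻¹ obeys the same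
quadratic formula on differential polynomials (`primitive_eq_sum`). With q = -½ (m₀)₀₁ and r = -½
(m₀)₁₀, induction gives K_{1,j} = ½ (m_j)₀₁ and K_{2,j} = -½ (m_j)₁₀ (`evalAt_K_of_recursion`). A
flow φ' = κ Aᵖφ, ψ' = -κ Aᵖψ yields (m₀)₀₁' = -2κ (m_p)₀₁ (`hasDerivAt_moment_zero`); κ = i/2 and p
= 2l is the required equation.

Cramer's rule identifies -½ (m₀)₀₁ with the quotient of double Wronskians (`two_mul_wronskian_div`).
The conditions on A and T relate the conjugate of B at σx to B at x by an exchange of the two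
blocks, which turns δ q*(σx) into r(x) (`Compatible.conj_leadMatrix`). For the Jordan block, the
matrix acts on Taylor coefficients at k as multiplication by the variable, so its exponential acts
as multiplication by e^θ (`ActsOnJets.exp`). -/

namespace AKNS

open Matrix

variable {n : ℕ}

/-! ### The Krylov matrix, its involution and the rank-two commutator -/

/-- The matrix with the columns `φ, Aφ, …, Aⁿφ, ψ, Aψ, …, Aⁿψ`. -/
noncomputable def krylov (A : Matrix (Idx n) (Idx n) ℂ) (φ ψ : Idx n → ℂ) :
    Matrix (Idx n) (Idx n) ℂ :=
  Matrix.of fun i c => Sum.elim (fun j : Fin (n + 1) => (A ^ (j : ℕ)).mulVec φ i)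
    (fun j : Fin (n + 1) => (A ^ (j : ℕ)).mulVec ψ i) c

/-- The block matrix `diag(I, -I)`. -/
def blockSign (n : ℕ) : Matrix (Idx n) (Idx n) ℂ := Matrix.fromBlocks 1 0 0 (-1)

/-- The third Pauli matrix. -/
def pauli : Matrix (Fin 2) (Fin 2) ℂ := !![1, 0; 0, -1]

/-- The two columns of the identity matrix at the ends of the two blocks. -/
def lastCols (n : ℕ) : Matrix (Idx n) (Fin 2) ℂ :=
  Matrix.of fun i c => if i = ![Sum.inl (Fin.last n), Sum.inr (Fin.last n)] c then 1 else 0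

theorem blockSign_mul_self : blockSign n * blockSign n = 1 := by
  simp [blockSign, fromBlocks_multiply]

theorem pauli_mul_self : pauli * pauli = 1 := by
  ext i j; fin_cases i <;> fin_cases j <;> simp [pauli]

theorem mul_lastCols_apply {ι : Type*} (M : Matrix ι (Idx n) ℂ) (i : ι) (c : Fin 2) :
    (M * lastCols n) i c = M i (![Sum.inl (Fin.last n), Sum.inr (Fin.last n)] c) := by
  simp [Matrix.mul_apply, lastCols]

theorem lastCols_transpose_mul_apply {ι : Type*} (M : Matrix (Idx n) ι ℂ) (i : ι) (c : Fin 2) :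
    ((lastCols n)ᵀ * M) c i = M (![Sum.inl (Fin.last n), Sum.inr (Fin.last n)] c) i := by
  simp [Matrix.mul_apply, lastCols]

theorem blockSign_mul_lastCols : blockSign n * lastCols n = lastCols n * pauli := by
  ext i c
  rw [mul_lastCols_apply, Matrix.mul_apply, Fin.sum_univ_two]
  rcases i with i | i <;> fin_cases c <;>
    simp [lastCols, pauli, blockSign, Matrix.one_apply, neg_ite]

theorem lastCols_transpose_mul_blockSign :
    (lastCols n)ᵀ * blockSign n = pauli * (lastCols n)ᵀ := by
  have h := congrArg Matrix.transpose (blockSign_mul_lastCols (n := n))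
  have h1 : (blockSign n)ᵀ = blockSign n := by simp [blockSign, fromBlocks_transpose]
  have h2 : pauliᵀ = pauli := by ext i j; fin_cases i <;> fin_cases j <;> simp [pauli]
  rwa [transpose_mul, transpose_mul, h1, h2] at h

/-- The involution `B diag(I, -I) B⁻¹`. -/
noncomputable def involution (B : Matrix (Idx n) (Idx n) ℂ) : Matrix (Idx n) (Idx n) ℂ :=
  B * blockSign n * B⁻¹

/-- The functionals giving the coordinates of `Aⁿφ` and `Aⁿψ` in the basis `B`. -/
noncomputable def leadCoords (B : Matrix (Idx n) (Idx n) ℂ) : Matrix (Fin 2) (Idx n) ℂ :=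
  (lastCols n)ᵀ * B⁻¹

/-- The two vectors which factor the commutator of `A` and the involution. -/
noncomputable def commFactor (A B : Matrix (Idx n) (Idx n) ℂ) : Matrix (Idx n) (Fin 2) ℂ :=
  A * (B * lastCols n) * pauli - involution B * (A * (B * lastCols n))

/-- The coefficients in the expansion of the dressed Pauli matrix in the inverse spectral
parameter. -/
noncomputable def moment (A B : Matrix (Idx n) (Idx n) ℂ) (j : ℕ) : Matrix (Fin 2) (Fin 2) ℂ :=
  leadCoords B * A ^ j * commFactor A B

section algebra

variable {A B : Matrix (Idx n) (Idx n) ℂ}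

theorem involution_mul_basis (hB : IsUnit B.det) : involution B * B = B * blockSign n := by
  rw [involution, Matrix.mul_assoc, nonsing_inv_mul B hB, Matrix.mul_one]

theorem involution_mul_self (hB : IsUnit B.det) : involution B * involution B = 1 := by
  calc involution B * involution B = involution B * B * blockSign n * B⁻¹ := by
        simp only [involution, Matrix.mul_assoc]
    _ = B * (blockSign n * blockSign n) * B⁻¹ := by
        rw [involution_mul_basis hB]; simp only [Matrix.mul_assoc]
    _ = 1 := by rw [blockSign_mul_self, Matrix.mul_one, mul_nonsing_inv B hB]

theorem leadCoords_mul_basis (hB : IsUnit B.det) : leadCoords B * B = (lastCols n)ᵀ := by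
  rw [leadCoords, Matrix.mul_assoc, nonsing_inv_mul B hB, Matrix.mul_one]

theorem leadCoords_mul_involution (hB : IsUnit B.det) :
    leadCoords B * involution B = pauli * leadCoords B := by
  calc leadCoords B * involution B = leadCoords B * B * blockSign n * B⁻¹ := by
        simp only [involution, Matrix.mul_assoc]
    _ = _ := by
        rw [leadCoords_mul_basis hB, lastCols_transpose_mul_blockSign, leadCoords,
          Matrix.mul_assoc]

/-- With Y = A B E, E the two end columns of the identity, the factor is Y `pauli` - Z Y; as Z² = 1
and `pauli`² = 1, multiplication by Z exchanges the two terms up to -`pauli`. -/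
theorem involution_mul_commFactor (hB : IsUnit B.det) :
    involution B * commFactor A B = -(commFactor A B * pauli) := by
  rw [commFactor, Matrix.mul_sub, Matrix.sub_mul, ← Matrix.mul_assoc (involution B) (involution B),
    involution_mul_self hB, Matrix.mul_assoc (A * (B * lastCols n)), pauli_mul_self, Matrix.one_mul,
    Matrix.mul_one, neg_sub, ← Matrix.mul_assoc]

theorem mul_krylov_inl (A : Matrix (Idx n) (Idx n) ℂ) (φ ψ : Idx n → ℂ) (i : Idx n)
    (j : Fin (n + 1)) :
    (A * krylov A φ ψ) i (Sum.inl j) = (A ^ ((j : ℕ) + 1)).mulVec φ i := by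
  rw [pow_succ', ← Matrix.mulVec_mulVec]; rfl

theorem mul_krylov_inr (A : Matrix (Idx n) (Idx n) ℂ) (φ ψ : Idx n → ℂ) (i : Idx n)
    (j : Fin (n + 1)) :
    (A * krylov A φ ψ) i (Sum.inr j) = (A ^ ((j : ℕ) + 1)).mulVec ψ i := by
  rw [pow_succ', ← Matrix.mulVec_mulVec]; rfl

theorem mul_blockSign_inl {ι : Type*} (M : Matrix ι (Idx n) ℂ) (i : ι) (j : Fin (n + 1)) :
    (M * blockSign n) i (Sum.inl j) = M i (Sum.inl j) := by
  simp [Matrix.mul_apply, blockSign, Matrix.one_apply]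

theorem mul_blockSign_inr {ι : Type*} (M : Matrix ι (Idx n) ℂ) (i : ι) (j : Fin (n + 1)) :
    (M * blockSign n) i (Sum.inr j) = -M i (Sum.inr j) := by
  simp [Matrix.mul_apply, blockSign, Matrix.one_apply]

/-- The commutator of `A` and the involution has rank two. -/
theorem commutator_eq {φ ψ : Idx n → ℂ} (hB : IsUnit (krylov A φ ψ).det) :
    A * involution (krylov A φ ψ) - involution (krylov A φ ψ) * A =
      commFactor A (krylov A φ ψ) * leadCoords (krylov A φ ψ) := by
  set B := krylov A φ ψ with hBdef
  set Z := involution B with hZ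
  have hZB : Z * B = B * blockSign n := involution_mul_basis hB
  -- After multiplication by B the relation can be checked column by column, because Z B = B diag(I,
  -- -I).
  have key : (A * Z - Z * A) * B = commFactor A B * (lastCols n)ᵀ := by
    have h1 : (A * Z - Z * A) * B = A * B * blockSign n - Z * (A * B) := by
      rw [Matrix.sub_mul, Matrix.mul_assoc A, hZB]; simp only [Matrix.mul_assoc]
    have hW : commFactor A B = A * B * blockSign n * lastCols n - Z * (A * B) * lastCols n := by
      rw [commFactor, Matrix.mul_assoc (A * B), blockSign_mul_lastCols, ← hZ]
      simp only [Matrix.mul_assoc]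
    rw [hW, ← Matrix.sub_mul, h1]
    set M := A * B * blockSign n - Z * (A * B) with hM
    -- Away from the end of a block, A sends a column of B to the next one, on which Z acts with the
    -- same sign, so the two terms cancel.
    have hsl : ∀ i (j : Fin (n + 1)), j ≠ Fin.last n → M i (Sum.inl j) = 0 := by
      intro i j hj
      obtain ⟨k, rfl⟩ := Fin.exists_castSucc_eq.mpr hj
      have hcol : ∀ i, (A * B) i (Sum.inl k.castSucc) = B i (Sum.inl k.succ) := by
        intro i
        rw [hBdef, mul_krylov_inl]; simp [krylov]
      have h2 : (Z * (A * B)) i (Sum.inl k.castSucc) = (Z * B) i (Sum.inl k.succ) := by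
        rw [Matrix.mul_apply, Matrix.mul_apply]
        exact Finset.sum_congr rfl fun k _ => by rw [hcol]
      rw [hM, Matrix.sub_apply, h2, hZB, mul_blockSign_inl, mul_blockSign_inl, hcol, sub_self]
    have hsr : ∀ i (j : Fin (n + 1)), j ≠ Fin.last n → M i (Sum.inr j) = 0 := by
      intro i j hj
      obtain ⟨k, rfl⟩ := Fin.exists_castSucc_eq.mpr hj
      have hcol : ∀ i, (A * B) i (Sum.inr k.castSucc) = B i (Sum.inr k.succ) := by
        intro i
        rw [hBdef, mul_krylov_inr]; simp [krylov]
      have h2 : (Z * (A * B)) i (Sum.inr k.castSucc) = (Z * B) i (Sum.inr k.succ) := by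
        rw [Matrix.mul_apply, Matrix.mul_apply]
        exact Finset.sum_congr rfl fun k _ => by rw [hcol]
      rw [hM, Matrix.sub_apply, h2, hZB, mul_blockSign_inr, mul_blockSign_inr, hcol, sub_self]
    ext i c
    rw [Matrix.mul_apply, Fin.sum_univ_two, mul_lastCols_apply, mul_lastCols_apply]
    rcases c with c | c
    · by_cases hc : c = Fin.last n
      · subst hc; simp [lastCols]
      · rw [hsl i c hc]; simp [lastCols, hc]
    · by_cases hc : c = Fin.last n
      · subst hc; simp [lastCols]
      · rw [hsr i c hc]; simp [lastCols, hc]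
  calc A * Z - Z * A = (A * Z - Z * A) * B * B⁻¹ := by
        rw [Matrix.mul_assoc, mul_nonsing_inv B hB, Matrix.mul_one]
    _ = _ := by rw [key, Matrix.mul_assoc]; rfl

end algebra

/-! ### Algebraic identities of the moments: S² = 1 and the Lax commutator -/

section moments

variable {A Z : Matrix (Idx n) (Idx n) ℂ} {l : Matrix (Fin 2) (Idx n) ℂ}
  {W : Matrix (Idx n) (Fin 2) ℂ}

/-- The commutator with Z is a derivation, so Leibniz' rule carries the factorization from A to its
powers. -/
theorem involution_mul_pow_sub (hc : A * Z - Z * A = W * l) (j : ℕ) :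
    A ^ j * Z - Z * A ^ j = ∑ i ∈ Finset.range j, A ^ i * W * (l * A ^ (j - 1 - i)) := by
  induction j with
  | zero => simp
  | succ j ih =>
    have h : A ^ (j + 1) * Z - Z * A ^ (j + 1) =
        (A ^ j * Z - Z * A ^ j) * A + A ^ j * (A * Z - Z * A) := by
      rw [pow_succ]; noncomm_ring
    rw [h, ih, hc, Finset.sum_range_succ, Finset.sum_mul]
    congr 1
    · refine Finset.sum_congr rfl fun i hi => ?_
      have : j + 1 - 1 - i = (j - 1 - i) + 1 := by have := Finset.mem_range.mp hi; omega
      rw [this, pow_succ]; simp only [Matrix.mul_assoc]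
    · simp [Matrix.mul_assoc]

/-- This is the coefficient of λ^{-j-1} in S² = 1. The relations of Z with l and W turn the left
side into -l (AʲZ - ZAʲ) W. -/
theorem anticommutator_of_realization (hl : l * Z = pauli * l) (hW : Z * W = -(W * pauli))
    (hc : A * Z - Z * A = W * l) (j : ℕ) :
    pauli * (l * A ^ j * W) + l * A ^ j * W * pauli =
      -∑ i ∈ Finset.range j, l * A ^ i * W * (l * A ^ (j - 1 - i) * W) := by
  have h1 : pauli * (l * A ^ j * W) = l * (Z * A ^ j) * W := by
    rw [← Matrix.mul_assoc, ← Matrix.mul_assoc, ← hl]; simp only [Matrix.mul_assoc]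
  have h2 : l * A ^ j * W * pauli = -(l * (A ^ j * Z) * W) := by
    rw [Matrix.mul_assoc (l * A ^ j), ← neg_eq_iff_eq_neg.mpr hW]
    simp only [Matrix.mul_assoc, Matrix.mul_neg]
  have h3 : pauli * (l * A ^ j * W) + l * A ^ j * W * pauli =
      -(l * (A ^ j * Z - Z * A ^ j) * W) := by
    rw [h1, h2, Matrix.mul_sub, Matrix.sub_mul]; abel
  rw [h3, involution_mul_pow_sub hc, Matrix.mul_sum, Matrix.sum_mul]
  simp only [Matrix.mul_assoc]

/-- The left side is what the x-flow produces from m_j, up to a factor; moving A past Z turns it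
into a coefficient of [λ `pauli` + m₀, S]. -/
theorem flow_of_realization (hl : l * Z = pauli * l) (hW : Z * W = -(W * pauli))
    (hc : A * Z - Z * A = W * l) (j : ℕ) :
    l * (A * Z * A ^ j + A ^ j * Z * A) * W =
      pauli * (l * A ^ (j + 1) * W) - l * A ^ (j + 1) * W * pauli +
        (l * W * (l * A ^ j * W) - l * A ^ j * W * (l * W)) := by
  have h1 : A * Z * A ^ j = Z * A ^ (j + 1) + W * l * A ^ j := by
    rw [← hc, pow_succ']; noncomm_ring
  have h2 : A ^ j * Z * A = A ^ (j + 1) * Z - A ^ j * (W * l) := by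
    rw [← hc, pow_succ]; noncomm_ring
  have h3 : pauli * (l * A ^ (j + 1) * W) = l * (Z * A ^ (j + 1)) * W := by
    rw [← Matrix.mul_assoc, ← Matrix.mul_assoc, ← hl]; simp only [Matrix.mul_assoc]
  have h4 : l * A ^ (j + 1) * W * pauli = -(l * (A ^ (j + 1) * Z) * W) := by
    rw [Matrix.mul_assoc (l * A ^ (j + 1)), ← neg_eq_iff_eq_neg.mpr hW]
    simp only [Matrix.mul_assoc, Matrix.mul_neg]
  rw [h1, h2, h3, h4]
  simp only [Matrix.mul_add, Matrix.mul_sub, Matrix.add_mul, Matrix.sub_mul, Matrix.mul_assoc]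
  abel

end moments

/-! ### Entrywise calculus of matrix-valued functions -/

/-- Entrywise differentiability of a matrix-valued function. -/
def HasEntryDerivAt {m k : Type*} (M : ℝ → Matrix m k ℂ) (M' : Matrix m k ℂ) (s : ℝ) : Prop :=
  ∀ i j, HasDerivAt (fun y => M y i j) (M' i j) s

namespace HasEntryDerivAt

variable {m k l : Type*} {s : ℝ}

theorem const (M : Matrix m k ℂ) (s : ℝ) : HasEntryDerivAt (fun _ => M) 0 s :=
  fun _ _ => hasDerivAt_const _ _

theorem sub {M N : ℝ → Matrix m k ℂ} {M' N' : Matrix m k ℂ} (hM : HasEntryDerivAt M M' s)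
    (hN : HasEntryDerivAt N N' s) : HasEntryDerivAt (fun y => M y - N y) (M' - N') s :=
  fun i j => (hM i j).sub (hN i j)

theorem mul [Fintype k] {M : ℝ → Matrix m k ℂ} {N : ℝ → Matrix k l ℂ} {M' : Matrix m k ℂ}
    {N' : Matrix k l ℂ} (hM : HasEntryDerivAt M M' s) (hN : HasEntryDerivAt N N' s) :
    HasEntryDerivAt (fun y => M y * N y) (M' * N s + M s * N') s := by
  intro i j
  have h := HasDerivAt.fun_sum (u := Finset.univ) fun c _ => (hM i c).mul (hN c j)
  simp only [Matrix.mul_apply, Matrix.add_apply, ← Finset.sum_add_distrib]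
  exact h

theorem const_mul [Fintype k] (M : Matrix m k ℂ) {N : ℝ → Matrix k l ℂ}
    {N' : Matrix k l ℂ} (hN : HasEntryDerivAt N N' s) :
    HasEntryDerivAt (fun y => M * N y) (M * N') s := by
  simpa using (const M s).mul hN

theorem mul_const [Fintype k] {M : ℝ → Matrix m k ℂ} {M' : Matrix m k ℂ}
    (hM : HasEntryDerivAt M M' s) (N : Matrix k l ℂ) :
    HasEntryDerivAt (fun y => M y * N) (M' * N) s := by
  simpa using hM.mul (const N s)

theorem congr_deriv {M : ℝ → Matrix m k ℂ} {M' N' : Matrix m k ℂ} (hM : HasEntryDerivAt M M' s)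
    (h : M' = N') : HasEntryDerivAt M N' s := h ▸ hM

theorem unique {M N : ℝ → Matrix m k ℂ} {M' N' : Matrix m k ℂ} (hM : HasEntryDerivAt M M' s)
    (hN : HasEntryDerivAt N N' s) (h : M =ᶠ[nhds s] N) : M' = N' := by
  ext i j
  refine (hM i j).unique ((hN i j).congr_of_eventuallyEq ?_)
  filter_upwards [h] with y hy
  rw [hy]

theorem differentiableAt_det [Fintype m] [DecidableEq m] {M : ℝ → Matrix m m ℂ}
    (hM : ∀ i j, DifferentiableAt ℝ (fun y => M y i j) s) :
    DifferentiableAt ℝ (fun y => (M y).det) s := by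
  simp only [Matrix.det_apply]
  exact DifferentiableAt.fun_sum fun σ _ =>
    (DifferentiableAt.fun_finsetProd fun i _ => hM _ _).const_smul (Equiv.Perm.sign σ)

/-- The adjugate formula gives differentiability; the value then follows by differentiating M⁻¹ M =
1, which holds near the point because the determinant stays nonzero. -/
theorem inv [Fintype m] [DecidableEq m] {M : ℝ → Matrix m m ℂ} {M' : Matrix m m ℂ}
    (hM : HasEntryDerivAt M M' s) (h : (M s).det ≠ 0) :
    HasEntryDerivAt (fun y => (M y)⁻¹) (-((M s)⁻¹ * M' * (M s)⁻¹)) s := by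
  have hd : DifferentiableAt ℝ (fun y => (M y).det) s :=
    differentiableAt_det fun i j => (hM i j).differentiableAt
  have hdiff : ∀ i j, DifferentiableAt ℝ (fun y => (M y)⁻¹ i j) s := by
    intro i j
    simp only [Matrix.inv_def, Matrix.smul_apply, Ring.inverse_eq_inv', smul_eq_mul,
      Matrix.adjugate_apply]
    refine (hd.inv h).mul (differentiableAt_det fun a b => ?_)
    simp only [Matrix.updateRow_apply]
    split_ifs
    · exact differentiableAt_const _
    · exact (hM a b).differentiableAt
  set N' : Matrix m m ℂ := Matrix.of fun i j => deriv (fun y => (M y)⁻¹ i j) s with hN'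
  have hN : HasEntryDerivAt (fun y => (M y)⁻¹) N' s := fun i j => (hdiff i j).hasDerivAt
  have hev : (fun y => (M y)⁻¹ * M y) =ᶠ[nhds s] fun _ => 1 := by
    filter_upwards [hd.continuousAt.eventually_ne h] with y hy
    exact Matrix.nonsing_inv_mul _ (isUnit_iff_ne_zero.mpr hy)
  have h0 := (hN.mul hM).unique (const 1 s) hev
  have hinv := Matrix.mul_nonsing_inv (M s) (isUnit_iff_ne_zero.mpr h)
  have h1 : N' = -((M s)⁻¹ * M' * (M s)⁻¹) := by
    calc N' = N' * (M s * (M s)⁻¹) := by rw [hinv, Matrix.mul_one]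
      _ = (N' * M s + (M s)⁻¹ * M') * (M s)⁻¹ - (M s)⁻¹ * M' * (M s)⁻¹ := by
          rw [Matrix.add_mul, Matrix.mul_assoc]; abel
      _ = _ := by rw [h0]; simp
  exact h1 ▸ hN

end HasEntryDerivAt

/-! ### Evolution of the involution and of the moments under a linear flow -/

section flow

variable {A : Matrix (Idx n) (Idx n) ℂ} {B : ℝ → Matrix (Idx n) (Idx n) ℂ} {s : ℝ} {κ : ℂ} {p : ℕ}

/-- Powers of A commute, so every column obeys the equation of φ or of ψ; the opposite sign for ψ is
the factor `blockSign n`. -/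
theorem HasEntryDerivAt.krylov {φ ψ : ℝ → Idx n → ℂ}
    (hφ : ∀ i, HasDerivAt (fun y => φ y i) (κ * (A ^ p).mulVec (φ s) i) s)
    (hψ : ∀ i, HasDerivAt (fun y => ψ y i) (-(κ * (A ^ p).mulVec (ψ s) i)) s) :
    HasEntryDerivAt (fun y => AKNS.krylov A (φ y) (ψ y))
      (κ • (A ^ p * AKNS.krylov A (φ s) (ψ s) * blockSign n)) s := by
  have key : ∀ (χ : ℝ → Idx n → ℂ) (c : ℂ) (j : ℕ) (i : Idx n),
      (∀ i, HasDerivAt (fun y => χ y i) (c * (A ^ p).mulVec (χ s) i) s) →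
      HasDerivAt (fun y => (A ^ j).mulVec (χ y) i)
        (c * ((A ^ p).mulVec ((A ^ j).mulVec (χ s)) i)) s := by
    intro χ c j i h
    have h1 := HasDerivAt.fun_sum (u := Finset.univ) fun a _ => (h a).const_mul ((A ^ j) i a)
    refine HasDerivAt.congr_deriv (f := fun y => (A ^ j).mulVec (χ y) i) h1 ?_
    rw [Matrix.mulVec_mulVec, ← pow_add, add_comm p j, pow_add, ← Matrix.mulVec_mulVec]
    simp only [Matrix.mulVec, dotProduct, Finset.mul_sum]
    exact Finset.sum_congr rfl fun a _ => Finset.sum_congr rfl fun b _ => by ring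
  have hcol : ∀ i c, (A ^ p * AKNS.krylov A (φ s) (ψ s)) i c =
      (A ^ p).mulVec (fun a => AKNS.krylov A (φ s) (ψ s) a c) i := fun i c => rfl
  intro i c
  rcases c with c | c
  · have := key φ κ c i hφ
    rw [Matrix.smul_apply, mul_blockSign_inl, hcol]
    exact this
  · have := key ψ (-κ) c i (fun i => by simpa using hψ i)
    rw [Matrix.smul_apply, mul_blockSign_inr, hcol]
    rw [neg_mul] at this
    rw [smul_eq_mul, mul_neg]
    exact this

variable (hB : (B s).det ≠ 0)
  (hd : HasEntryDerivAt B (κ • (A ^ p * B s * blockSign n)) s)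
include hB hd

theorem HasEntryDerivAt.leadCoords :
    HasEntryDerivAt (fun y => AKNS.leadCoords (B y))
      (-(κ • (AKNS.leadCoords (B s) * A ^ p * involution (B s)))) s := by
  refine ((hd.inv hB).const_mul (lastCols n)ᵀ).congr_deriv ?_
  simp only [AKNS.leadCoords, involution, Matrix.mul_assoc, Matrix.smul_mul, Matrix.mul_smul,
    Matrix.mul_neg]

theorem HasEntryDerivAt.involution :
    HasEntryDerivAt (fun y => AKNS.involution (B y))
      (κ • (A ^ p - AKNS.involution (B s) * A ^ p * AKNS.involution (B s))) s := by
  refine ((hd.mul_const (blockSign n)).mul (hd.inv hB)).congr_deriv ?_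
  have h1 : A ^ p * B s * blockSign n * blockSign n * (B s)⁻¹ = A ^ p := by
    rw [Matrix.mul_assoc _ (blockSign n) (blockSign n), blockSign_mul_self, Matrix.mul_one,
      Matrix.mul_assoc,
      mul_nonsing_inv _ (isUnit_iff_ne_zero.mpr hB), Matrix.mul_one]
  rw [Matrix.smul_mul, Matrix.smul_mul, h1, smul_sub, sub_eq_add_neg]
  simp only [AKNS.involution, Matrix.mul_assoc, Matrix.smul_mul, Matrix.mul_smul,
    Matrix.mul_neg]

/-- The derivatives of Y `pauli` and of Z both contain κ Aᵖ Y, and these contributions cancel; what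
remains has Z Aᵖ on the left. -/
theorem HasEntryDerivAt.commFactor :
    HasEntryDerivAt (fun y => AKNS.commFactor A (B y))
      (-(κ • (AKNS.involution (B s) * A ^ p * AKNS.commFactor A (B s)))) s := by
  have hY : HasEntryDerivAt (fun y => A * (B y * lastCols n))
      (κ • (A ^ p * (A * (B s * lastCols n)) * pauli)) s := by
    refine ((hd.mul_const (lastCols n)).const_mul A).congr_deriv ?_
    have h1 : A ^ p * A = A * A ^ p := by rw [← pow_succ, pow_succ']
    rw [← Matrix.mul_assoc (A ^ p) A, h1]
    simp only [Matrix.smul_mul, Matrix.mul_smul, Matrix.mul_assoc, blockSign_mul_lastCols]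
  refine ((hY.mul_const pauli).sub ((HasEntryDerivAt.involution hB hd).mul hY)).congr_deriv ?_
  simp only [AKNS.commFactor]
  set Z := AKNS.involution (B s)
  set Y := A * (B s * lastCols n)
  have h2 : κ • (A ^ p * Y * pauli) * pauli = κ • (A ^ p * Y) := by
    rw [Matrix.smul_mul, Matrix.mul_assoc _ pauli, pauli_mul_self, Matrix.mul_one]
  rw [h2, ← smul_neg, Matrix.smul_mul, Matrix.mul_smul, ← smul_add, ← smul_sub]
  congr 1
  simp only [Matrix.mul_sub, Matrix.sub_mul, Matrix.mul_assoc]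
  abel

theorem HasEntryDerivAt.moment (j : ℕ) :
    HasEntryDerivAt (fun y => AKNS.moment A (B y) j)
      (-(κ • (AKNS.leadCoords (B s) * (A ^ p * AKNS.involution (B s) * A ^ j +
        A ^ j * AKNS.involution (B s) * A ^ p) * AKNS.commFactor A (B s)))) s := by
  refine (((HasEntryDerivAt.leadCoords hB hd).mul_const (A ^ j)).mul
    (HasEntryDerivAt.commFactor hB hd)).congr_deriv ?_
  simp only [Matrix.mul_add, Matrix.add_mul, Matrix.mul_assoc, Matrix.smul_mul, Matrix.mul_smul,
    Matrix.mul_neg, Matrix.neg_mul, smul_add, neg_add]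

end flow

/-! ### Scalar recursions and evolution equations of the moments -/

section krylov

variable {A : Matrix (Idx n) (Idx n) ℂ} {φ ψ : Idx n → ℂ}

theorem moment_anticommutator (hB : (krylov A φ ψ).det ≠ 0) (j : ℕ) :
    pauli * moment A (krylov A φ ψ) j + moment A (krylov A φ ψ) j * pauli =
      -∑ i ∈ Finset.range j, moment A (krylov A φ ψ) i * moment A (krylov A φ ψ) (j - 1 - i) :=
  have hu := isUnit_iff_ne_zero.mpr hB
  anticommutator_of_realization (leadCoords_mul_involution hu) (involution_mul_commFactor hu)
    (commutator_eq hu) j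

/-- The diagonal entries of S² = 1 read 2 (m_j)₀₀ and -2 (m_j)₁₁ on the left. Earlier moments being
traceless by induction, the right sides agree after i ↦ j - 1 - i. The quadratic formula is what
replaces an integration in x. -/
theorem moment_diag (hB : (krylov A φ ψ).det ≠ 0) (j : ℕ) :
    moment A (krylov A φ ψ) j 1 1 = -moment A (krylov A φ ψ) j 0 0 ∧
    2 * moment A (krylov A φ ψ) j 0 0 = -∑ i ∈ Finset.range j,
      (moment A (krylov A φ ψ) i 0 0 * moment A (krylov A φ ψ) (j - 1 - i) 0 0 +
        moment A (krylov A φ ψ) i 0 1 * moment A (krylov A φ ψ) (j - 1 - i) 1 0) := by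
  induction j using Nat.strong_induction_on with
  | _ j ih =>
    have h := moment_anticommutator hB j
    have h00 := congrFun (congrFun h 0) 0
    have h11 := congrFun (congrFun h 1) 1
    simp only [Matrix.add_apply, Matrix.neg_apply, Matrix.sum_apply, Matrix.mul_apply,
      Fin.sum_univ_two, pauli, Matrix.of_apply, Matrix.cons_val_zero, Matrix.cons_val_one,
      Matrix.cons_val_fin_one] at h00 h11
    have h2 : 2 * moment A (krylov A φ ψ) j 0 0 = -∑ i ∈ Finset.range j,
      (moment A (krylov A φ ψ) i 0 0 * moment A (krylov A φ ψ) (j - 1 - i) 0 0 +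
        moment A (krylov A φ ψ) i 0 1 * moment A (krylov A φ ψ) (j - 1 - i) 1 0) := by
      rw [← h00]; ring
    refine ⟨?_, h2⟩
    have h3 : ∑ i ∈ Finset.range j,
        (moment A (krylov A φ ψ) i 1 0 * moment A (krylov A φ ψ) (j - 1 - i) 0 1 +
          moment A (krylov A φ ψ) i 1 1 * moment A (krylov A φ ψ) (j - 1 - i) 1 1) =
        ∑ i ∈ Finset.range j,
        (moment A (krylov A φ ψ) i 0 0 * moment A (krylov A φ ψ) (j - 1 - i) 0 0 +
          moment A (krylov A φ ψ) i 0 1 * moment A (krylov A φ ψ) (j - 1 - i) 1 0) := by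
      rw [← Finset.sum_range_reflect]
      refine Finset.sum_congr rfl fun i hi => ?_
      have hi' := Finset.mem_range.mp hi
      have e : j - 1 - (j - 1 - i) = i := by omega
      rw [e, (ih i hi').1, (ih (j - 1 - i) (by omega)).1]
      ring
    rw [h3] at h11
    linear_combination (1 / 2 : ℂ) * (h2 - h11)

theorem moment_zero_diag (hB : (krylov A φ ψ).det ≠ 0) :
    moment A (krylov A φ ψ) 0 0 0 = 0 ∧ moment A (krylov A φ ψ) 0 1 1 = 0 := by
  have h := moment_diag hB 0
  have h0 : moment A (krylov A φ ψ) 0 0 0 = 0 := by simpa using h.2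
  exact ⟨h0, by rw [h.1, h0, neg_zero]⟩

end krylov

section curves

variable {A : Matrix (Idx n) (Idx n) ℂ} {φ ψ : ℝ → Idx n → ℂ} {s : ℝ}

/-- The space evolution of the moments. -/
theorem hasDerivAt_moment_space (hB : (krylov A (φ s) (ψ s)).det ≠ 0)
    (hφ : ∀ i, HasDerivAt (fun y => φ y i) (1 / 2 * A.mulVec (φ s) i) s)
    (hψ : ∀ i, HasDerivAt (fun y => ψ y i) (-(1 / 2 * A.mulVec (ψ s) i)) s) (j : ℕ) :
    HasDerivAt (fun y => moment A (krylov A (φ y) (ψ y)) j 0 1)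
      (-moment A (krylov A (φ s) (ψ s)) (j + 1) 0 1 + moment A (krylov A (φ s) (ψ s)) 0 0 1 *
        moment A (krylov A (φ s) (ψ s)) j 0 0) s ∧
    HasDerivAt (fun y => moment A (krylov A (φ y) (ψ y)) j 1 0)
      (moment A (krylov A (φ s) (ψ s)) (j + 1) 1 0 - moment A (krylov A (φ s) (ψ s)) 0 1 0 *
        moment A (krylov A (φ s) (ψ s)) j 0 0) s := by
  have hu := isUnit_iff_ne_zero.mpr hB
  have hk := HasEntryDerivAt.krylov (A := A) (φ := φ) (ψ := ψ) (κ := 1 / 2) (p := 1) (s := s)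
    (by simpa using hφ) (by simpa using hψ)
  have hm := HasEntryDerivAt.moment (B := fun y => krylov A (φ y) (ψ y)) hB hk j
  have hf := flow_of_realization (leadCoords_mul_involution hu) (involution_mul_commFactor hu)
    (commutator_eq hu) j
  have h0 : leadCoords (krylov A (φ s) (ψ s)) * commFactor A (krylov A (φ s) (ψ s)) =
      moment A (krylov A (φ s) (ψ s)) 0 := by simp [moment]
  rw [pow_one, hf, h0] at hm
  simp only [← moment.eq_1] at hm
  obtain ⟨z0, z1⟩ := moment_zero_diag hB
  have d := (moment_diag hB j).1
  constructor
  · refine (hm 0 1).congr_deriv ?_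
    simp only [Matrix.add_apply, Matrix.sub_apply, Matrix.neg_apply, Matrix.smul_apply,
      Matrix.mul_apply, Fin.sum_univ_two, pauli, Matrix.of_apply, Matrix.cons_val_zero,
      Matrix.cons_val_one, Matrix.cons_val_fin_one, smul_eq_mul, z0, z1, d]
    ring
  · refine (hm 1 0).congr_deriv ?_
    simp only [Matrix.add_apply, Matrix.sub_apply, Matrix.neg_apply, Matrix.smul_apply,
      Matrix.mul_apply, Fin.sum_univ_two, pauli, Matrix.of_apply, Matrix.cons_val_zero,
      Matrix.cons_val_one, Matrix.cons_val_fin_one, smul_eq_mul, z0, z1, d]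
    ring

/-- The evolution of the leading moment in the flow of order `p`. -/
theorem hasDerivAt_moment_zero {κ : ℂ} {p : ℕ} (hB : (krylov A (φ s) (ψ s)).det ≠ 0)
    (hφ : ∀ i, HasDerivAt (fun y => φ y i) (κ * (A ^ p).mulVec (φ s) i) s)
    (hψ : ∀ i, HasDerivAt (fun y => ψ y i) (-(κ * (A ^ p).mulVec (ψ s) i)) s) :
    HasDerivAt (fun y => moment A (krylov A (φ y) (ψ y)) 0 0 1)
      (-2 * κ * moment A (krylov A (φ s) (ψ s)) p 0 1) s := by
  have hu := isUnit_iff_ne_zero.mpr hB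
  have hm := HasEntryDerivAt.moment (B := fun y => krylov A (φ y) (ψ y)) hB
    (HasEntryDerivAt.krylov hφ hψ) 0
  refine (hm 0 1).congr_deriv ?_
  set B := krylov A (φ s) (ψ s)
  -- For the leading moment Z is adjacent to W in one term and to l in the other, so it can be
  -- absorbed and only [`pauli`, m_p] is left.
  have h : leadCoords B * (A ^ p * involution B * A ^ 0 + A ^ 0 * involution B * A ^ p) *
      commFactor A B = pauli * moment A B p - moment A B p * pauli := by
    rw [moment, Matrix.mul_assoc (leadCoords B * A ^ p) _ pauli,
      ← neg_eq_iff_eq_neg.mpr (involution_mul_commFactor (A := A) hu), ← Matrix.mul_assoc pauli,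
      ← Matrix.mul_assoc pauli, ← leadCoords_mul_involution hu]
    simp only [pow_zero, Matrix.mul_one, Matrix.one_mul, Matrix.mul_add, Matrix.add_mul,
      Matrix.mul_assoc, Matrix.mul_neg]
    abel
  rw [h]
  simp only [Matrix.sub_apply, Matrix.neg_apply, Matrix.smul_apply,
      Matrix.mul_apply, Fin.sum_univ_two, pauli, Matrix.of_apply, Matrix.cons_val_zero,
      Matrix.cons_val_one, Matrix.cons_val_fin_one, smul_eq_mul]
  ring

end curves

/-! ### The quadratic recursion for differential polynomials and their evaluation -/

theorem constantCoeff_D (p : DiffPoly) : MvPolynomial.constantCoeff (D p) = 0 := by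
  induction p using MvPolynomial.induction_on with
  | C a => simp [D]
  | add p q hp hq => rw [map_add, map_add, hp, hq, add_zero]
  | mul_X p v hp =>
    rw [Derivation.leibniz, map_add, smul_eq_mul, smul_eq_mul, map_mul, map_mul, hp, D,
      MvPolynomial.mkDerivation_X]
    simp

/-- The primitive `∂ₓ⁻¹ (r K₁ + q K₂)` occurring in both rows of the hierarchy. -/
noncomputable def primitive (j : ℕ) : DiffPoly := Dinv (rv * (K j).1 + qv * (K j).2)

theorem K_succ (j : ℕ) : K (j + 1) = L (K j) := Function.iterate_succ_apply' _ _ _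

theorem K_succ_fst (j : ℕ) : (K (j + 1)).1 = -D (K j).1 + 2 * qv * primitive j := by
  rw [K_succ]; rfl

theorem K_succ_snd (j : ℕ) : (K (j + 1)).2 = D (K j).2 - 2 * rv * primitive j := by
  rw [K_succ]; rfl

theorem constantCoeff_K (j : ℕ) : MvPolynomial.constantCoeff (K j).1 = 0 ∧
    MvPolynomial.constantCoeff (K j).2 = 0 := by
  induction j with
  | zero => simp [K, qv, rv]
  | succ j _ => simp [K_succ_fst, K_succ_snd, constantCoeff_D, qv, rv]

theorem D_primitive (j : ℕ) : D (primitive j) = rv * (K j).1 + qv * (K j).2 :=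
  D_Dinv_hierarchy j

theorem constantCoeff_primitive (j : ℕ) : MvPolynomial.constantCoeff (primitive j) = 0 :=
  (D_Dinv ⟨_, D_primitive j⟩).2

/-- The primitives are quadratic expressions in the previous members of the hierarchy. -/
theorem primitive_eq_sum (n : ℕ) : primitive n = ∑ i ∈ Finset.range n,
    (primitive i * primitive (n - 1 - i) - (K i).1 * (K (n - 1 - i)).2) := by
  have hDa : ∀ i, D (K i).1 = 2 * qv * primitive i - (K (i + 1)).1 := fun i => by
    rw [K_succ_fst]; ring
  have hDb : ∀ i, D (K i).2 = (K (i + 1)).2 + 2 * rv * primitive i := fun i => by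
    rw [K_succ_snd]; ring
  -- It suffices to compare total derivatives and constant terms. In the derivative of the sum, the
  -- terms containing primitives cancel under i ↦ n - 1 - i and the others telescope.
  refine primitive_unique ?_ ?_
  · have hterm : ∀ i ∈ Finset.range n,
        D (primitive i * primitive (n - 1 - i) - (K i).1 * (K (n - 1 - i)).2) =
          (rv * primitive i * (K (n - 1 - i)).1 + qv * (K i).2 * primitive (n - 1 - i))
          - (rv * (K i).1 * primitive (n - 1 - i) + qv * primitive i * (K (n - 1 - i)).2)
          + ((K (i + 1)).1 * (K (n - (i + 1))).2 - (K i).1 * (K (n - i)).2) := by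
      intro i hi
      have hi' := Finset.mem_range.mp hi
      have e1 : n - (i + 1) = n - 1 - i := by omega
      have e2 : n - i = n - 1 - i + 1 := by omega
      rw [e1, e2]
      simp only [map_sub, Derivation.leibniz, smul_eq_mul]
      rw [D_primitive, D_primitive, hDa, hDb]
      ring
    rw [map_sum, Finset.sum_congr rfl hterm, Finset.sum_add_distrib, Finset.sum_sub_distrib,
      Finset.sum_range_sub (fun i => (K i).1 * (K (n - i)).2), D_primitive]
    have hrefl : ∑ i ∈ Finset.range n,
          (rv * primitive i * (K (n - 1 - i)).1 + qv * (K i).2 * primitive (n - 1 - i)) =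
        ∑ i ∈ Finset.range n,
          (rv * (K i).1 * primitive (n - 1 - i) + qv * primitive i * (K (n - 1 - i)).2) := by
      rw [← Finset.sum_range_reflect]
      refine Finset.sum_congr rfl fun i hi => ?_
      have hi' := Finset.mem_range.mp hi
      have e : n - 1 - (n - 1 - i) = i := by omega
      rw [e]; ring
    have h0 : K 0 = (-qv, rv) := rfl
    rw [hrefl, Nat.sub_self, h0, Nat.sub_zero]
    ring
  · rw [constantCoeff_primitive, map_sum, Finset.sum_eq_zero]
    intro i _
    simp [constantCoeff_primitive, constantCoeff_K]

theorem hasDerivAt_iteratedDeriv {u : ℝ → ℂ} {x : ℝ} (hu : ContDiffAt ℝ ∞ u x) (k : ℕ) :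
    HasDerivAt (iteratedDeriv k u) (iteratedDeriv (k + 1) u x) x := by
  rw [iteratedDeriv_succ]
  have h := hu.contDiffWithinAt (s := Set.univ)
  have h1 := h.differentiableWithinAt_iteratedDerivWithin (m := k)
    (by exact_mod_cast WithTop.coe_lt_top k) (by simp [uniqueDiffOn_univ])
  rw [iteratedDerivWithin_univ, differentiableWithinAt_univ] at h1
  exact h1.hasDerivAt

theorem hasDerivAt_evalAt {u v : ℝ → ℂ} {x : ℝ} (hu : ContDiffAt ℝ ∞ u x)
    (hv : ContDiffAt ℝ ∞ v x) (p : DiffPoly) :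
    HasDerivAt (fun y => evalAt p u v y) (evalAt (D p) u v x) x := by
  induction p using MvPolynomial.induction_on with
  | C a => simpa [evalAt, D] using hasDerivAt_const x a
  | add p q hp hq => simp only [evalAt, map_add]; exact hp.add hq
  | mul_X p w hp =>
    have hw : HasDerivAt (iteratedDeriv w.2 (if w.1 = 0 then u else v))
        (iteratedDeriv (w.2 + 1) (if w.1 = 0 then u else v) x) x := by
      split_ifs
      · exact hasDerivAt_iteratedDeriv hu _
      · exact hasDerivAt_iteratedDeriv hv _
    have h := hp.mul hw
    have e : (fun y => evalAt (p * X w) u v y) =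
        (fun y => evalAt p u v y) * iteratedDeriv w.2 (if w.1 = 0 then u else v) := by
      funext y; simp [evalAt]
    rw [e]
    refine h.congr_deriv ?_
    rw [Derivation.leibniz, D, MvPolynomial.mkDerivation_X]
    simp only [evalAt, smul_eq_mul, map_add, map_mul, MvPolynomial.eval_X]
    ring

/-- Functions obeying the differential and quadratic recursions are the evaluations of the
members of the hierarchy. -/
theorem evalAt_K_of_recursion {u v : ℝ → ℂ} {S : Set ℝ} (hS : IsOpen S) {a b c : ℕ → ℝ → ℂ}
    (hu : ∀ x ∈ S, ContDiffAt ℝ ∞ u x) (hv : ∀ x ∈ S, ContDiffAt ℝ ∞ v x)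
    (hu0 : ∀ x ∈ S, u x = -(1 / 2) * b 0 x) (hv0 : ∀ x ∈ S, v x = -(1 / 2) * c 0 x)
    (hb : ∀ j, ∀ x ∈ S, HasDerivAt (b j) (-b (j + 1) x + b 0 x * a j x) x)
    (hc : ∀ j, ∀ x ∈ S, HasDerivAt (c j) (c (j + 1) x - c 0 x * a j x) x)
    (ha : ∀ j, ∀ x ∈ S, 2 * a j x =
      -∑ i ∈ Finset.range j, (a i x * a (j - 1 - i) x + b i x * c (j - 1 - i) x)) (j : ℕ) :
    ∀ x ∈ S, evalAt (K j).1 u v x = 1 / 2 * b j x ∧ evalAt (K j).2 u v x = -(1 / 2) * c j x ∧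
      evalAt (primitive j) u v x = -(1 / 2) * a j x := by
  induction j using Nat.strong_induction_on with
  | _ j ih =>
    have hK : ∀ x ∈ S, evalAt (K j).1 u v x = 1 / 2 * b j x ∧
        evalAt (K j).2 u v x = -(1 / 2) * c j x := by
      intro x hx
      rcases j with _ | j
      · have h0 : K 0 = (-qv, rv) := rfl
        rw [h0]
        simp only [evalAt, qv, rv, map_neg, MvPolynomial.eval_X, iteratedDeriv_zero]
        simp [hu0 x hx, hv0 x hx]
      · have ihj := ih j (by omega)
        have hq : evalAt qv u v x = u x := by simp [evalAt, qv]
        have hr : evalAt rv u v x = v x := by simp [evalAt, rv]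
        -- The previous identity holds on a neighbourhood of x because S is open, so it may be
        -- differentiated.
        have h1 : evalAt (D (K j).1) u v x = 1 / 2 * (-b (j + 1) x + b 0 x * a j x) := by
          refine (hasDerivAt_evalAt (hu x hx) (hv x hx) _).unique
            (((hb j x hx).const_mul (1 / 2)).congr_of_eventuallyEq ?_)
          filter_upwards [hS.mem_nhds hx] with y hy using (ihj y hy).1
        have h2 : evalAt (D (K j).2) u v x = -(1 / 2) * (c (j + 1) x - c 0 x * a j x) := by
          refine (hasDerivAt_evalAt (hu x hx) (hv x hx) _).unique
            (((hc j x hx).const_mul (-(1 / 2))).congr_of_eventuallyEq ?_)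
          filter_upwards [hS.mem_nhds hx] with y hy using (ihj y hy).2.1
        have h3 := (ihj x hx).2.2
        rw [K_succ_fst, K_succ_snd]
        have e1 : evalAt (-D (K j).1 + 2 * qv * primitive j) u v x =
            -evalAt (D (K j).1) u v x + 2 * evalAt qv u v x * evalAt (primitive j) u v x := by
          simp [evalAt]
        have e2 : evalAt (D (K j).2 - 2 * rv * primitive j) u v x =
            evalAt (D (K j).2) u v x - 2 * evalAt rv u v x * evalAt (primitive j) u v x := by
          simp [evalAt]
        rw [e1, e2, h1, h2, h3, hq, hr, hu0 x hx, hv0 x hx]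
        constructor <;> ring
    intro x hx
    refine ⟨(hK x hx).1, (hK x hx).2, ?_⟩
    -- The primitive and `a j` are the same quadratic expression in lower members, so no integration
    -- constant enters.
    have e : evalAt (primitive j) u v x = ∑ i ∈ Finset.range j,
        (evalAt (primitive i) u v x * evalAt (primitive (j - 1 - i)) u v x -
          evalAt (K i).1 u v x * evalAt (K (j - 1 - i)).2 u v x) := by
      rw [primitive_eq_sum]; simp [evalAt, map_sum]
    have h2 : -(1 / 2 : ℂ) * a j x = -(1 / 4) * (2 * a j x) := by ring
    rw [e, h2, ha j x hx, mul_neg, neg_mul, neg_neg, Finset.mul_sum]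
    refine Finset.sum_congr rfl fun i hi => ?_
    have hi' := Finset.mem_range.mp hi
    obtain ⟨h1, -, h3⟩ := ih i hi' x hx
    obtain ⟨-, h4, h5⟩ := ih (j - 1 - i) (by omega) x hx
    rw [h1, h3, h4, h5]
    ring

/-! ### Double Wronskians as Krylov determinants -/

theorem Idx.pos_inl (j : Fin (n + 1)) : Idx.pos (Sum.inl j : Idx n) = j := by
  simp [Idx.pos]

theorem Idx.pos_inr (j : Fin (n + 1)) : Idx.pos (Sum.inr j : Idx n) = n + 1 + j := by
  simp [Idx.pos, add_comm]

/-- Column positions split into the first `n` and the last `n + 2`. -/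
def splitIdx (n : ℕ) : Idx n ≃ Fin n ⊕ Fin (n + 2) where
  toFun := Sum.elim (Fin.lastCases (Sum.inr 0) Sum.inl) fun j => Sum.inr j.succ
  invFun := Sum.elim (fun j => Sum.inl j.castSucc) (Fin.cases (Sum.inl (Fin.last n)) Sum.inr)
  left_inv := by
    rintro (j | j)
    · induction j using Fin.lastCases <;> simp
    · simp
  right_inv := by
    rintro (j | j)
    · simp
    · induction j using Fin.cases <;> simp

/-- The cyclic permutation of the last `n + 2` column positions. -/
def rotateTail (n : ℕ) : Equiv.Perm (Idx n) :=
  ((splitIdx n).trans (Equiv.Perm.sumCongr 1 (finRotate (n + 2)))).trans (splitIdx n).symm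

theorem sign_rotateTail : Equiv.Perm.sign (rotateTail n) = (-1) ^ (n + 1) := by
  rw [rotateTail, Equiv.Perm.sign_trans_trans_symm, Equiv.Perm.sign_sumCongr, sign_finRotate]
  simp

theorem rotateTail_inl_castSucc (j : Fin n) :
    rotateTail n (Sum.inl j.castSucc) = Sum.inl j.castSucc := by
  simp [rotateTail, splitIdx]

theorem rotateTail_inl_last : rotateTail n (Sum.inl (Fin.last n)) = Sum.inr 0 := by
  have : (1 : Fin (n + 2)) = Fin.succ 0 := rfl
  simp only [rotateTail, splitIdx, Equiv.trans_apply, Equiv.coe_fn_mk, Sum.elim_inl,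
    Fin.lastCases_last, Equiv.Perm.sumCongr_apply, Sum.map_inr, finRotate_apply, zero_add,
    Equiv.coe_fn_symm_mk, Sum.elim_inr, this, Fin.cases_succ]

theorem rotateTail_inr_castSucc (j : Fin n) :
    rotateTail n (Sum.inr j.castSucc) = Sum.inr j.succ := by
  have : j.castSucc.succ + 1 = j.succ.succ := by
    rw [Fin.succ_castSucc, Fin.coeSucc_eq_succ]
  simp only [rotateTail, splitIdx, Equiv.trans_apply, Equiv.coe_fn_mk, Sum.elim_inr,
    Equiv.Perm.sumCongr_apply, Sum.map_inr, finRotate_apply,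
    Equiv.coe_fn_symm_mk, this, Fin.cases_succ]

theorem rotateTail_inr_last : rotateTail n (Sum.inr (Fin.last n)) = Sum.inl (Fin.last n) := by
  simp only [rotateTail, splitIdx, Equiv.trans_apply, Equiv.coe_fn_mk, Sum.elim_inr,
    Equiv.Perm.sumCongr_apply, Sum.map_inr, Fin.succ_last, finRotate_last,
    Equiv.coe_fn_symm_mk, Fin.cases_zero]

/-- The coordinates along `Aⁿφ` and `Aⁿψ` of `Aⁿ⁺¹φ` and `Aⁿ⁺¹ψ`. -/
noncomputable def leadMatrix (A B : Matrix (Idx n) (Idx n) ℂ) : Matrix (Fin 2) (Fin 2) ℂ :=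
  leadCoords B * (A * (B * lastCols n))

/-- The leading moment is the commutator of `leadMatrix A B` with `pauli`. -/
theorem moment_zero_offDiag {A B : Matrix (Idx n) (Idx n) ℂ} (hB : B.det ≠ 0) :
    moment A B 0 0 1 = -2 * leadMatrix A B 0 1 ∧ moment A B 0 1 0 = 2 * leadMatrix A B 1 0 := by
  have h : moment A B 0 = leadMatrix A B * pauli - pauli * leadMatrix A B := by
    rw [moment, pow_zero, Matrix.mul_one, commFactor, Matrix.mul_sub, ← Matrix.mul_assoc,
      ← Matrix.mul_assoc (leadCoords B) (involution B),
      leadCoords_mul_involution (isUnit_iff_ne_zero.mpr hB), Matrix.mul_assoc pauli]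
    rfl
  rw [h]
  simp only [Matrix.sub_apply, Matrix.mul_apply, Fin.sum_univ_two, pauli, Matrix.of_apply,
    Matrix.cons_val_zero, Matrix.cons_val_one, Matrix.cons_val_fin_one]
  constructor <;> ring

theorem leadMatrix_eq_cramer (A : Matrix (Idx n) (Idx n) ℂ) (φ ψ : Idx n → ℂ) :
    leadMatrix A (krylov A φ ψ) 0 1 =
      ((krylov A φ ψ).updateCol (Sum.inl (Fin.last n)) ((A ^ (n + 1)).mulVec ψ)).det /
        (krylov A φ ψ).det := by
  rw [leadMatrix, leadCoords, Matrix.mul_assoc, lastCols_transpose_mul_apply, ← Matrix.mul_assoc A,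
    ← Matrix.mul_assoc, mul_lastCols_apply, ← Matrix.cramer_apply,
    Matrix.cramer_eq_adjugate_mulVec, Matrix.inv_def, Ring.inverse_eq_inv', Matrix.smul_mul,
    Matrix.smul_apply, div_eq_inv_mul, smul_eq_mul, Matrix.mul_apply]
  congr 1
  refine Finset.sum_congr rfl fun k _ => ?_
  congr 1
  exact (mul_krylov_inr A φ ψ k (Fin.last n)).trans (by simp)

section wronskian

variable {A : Matrix (Idx n) (Idx n) ℂ} {φ ψ : ℝ → Idx n → ℂ}

theorem iteratedDeriv_of_linear {κ : ℂ} {χ : ℝ → Idx n → ℂ}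
    (h : ∀ x i, HasDerivAt (fun y => χ y i) (κ * A.mulVec (χ x) i) x) (k : ℕ) (i : Idx n) :
    iteratedDeriv k (fun y => χ y i) = fun x => κ ^ k * (A ^ k).mulVec (χ x) i := by
  induction k with
  | zero => simp
  | succ k ih =>
    rw [iteratedDeriv_succ, ih]
    funext x
    have h1 := (HasDerivAt.fun_sum (u := Finset.univ) fun a _ =>
      (h x a).const_mul ((A ^ k) i a)).const_mul (κ ^ k)
    refine (HasDerivAt.congr_deriv (f := fun y => κ ^ k * (A ^ k).mulVec (χ y) i) h1 ?_).deriv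
    rw [pow_succ A, ← Matrix.mulVec_mulVec]
    simp only [Matrix.mulVec, dotProduct, Finset.mul_sum]
    refine Finset.sum_congr rfl fun a _ => Finset.sum_congr rfl fun b _ => by ring

theorem contDiff_of_linear {κ : ℂ} {χ : ℝ → Idx n → ℂ}
    (h : ∀ x i, HasDerivAt (fun y => χ y i) (κ * A.mulVec (χ x) i) x) (i : Idx n) :
    ContDiff ℝ ∞ (fun y => χ y i) := by
  refine contDiff_of_differentiable_iteratedDeriv fun m _ x => ?_
  rw [iteratedDeriv_of_linear h]
  have h1 := (HasDerivAt.fun_sum (u := Finset.univ) fun a _ =>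
      (h x a).const_mul ((A ^ m) i a)).const_mul (κ ^ m)
  exact h1.differentiableAt

theorem contDiff_det {ι : Type*} [Fintype ι] [DecidableEq ι] {M : ℝ → Matrix ι ι ℂ}
    (hM : ∀ i j, ContDiff ℝ ∞ (fun y => M y i j)) : ContDiff ℝ ∞ (fun y => (M y).det) := by
  simp only [Matrix.det_apply]
  exact ContDiff.sum fun σ _ => (contDiff_prod fun i _ => hM _ _).const_smul (Equiv.Perm.sign σ)

theorem contDiff_doubleWronskian (hφ : ∀ i, ContDiff ℝ ∞ (fun y => φ y i))
    (hψ : ∀ i, ContDiff ℝ ∞ (fun y => ψ y i)) (p : ℕ) :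
    ContDiff ℝ ∞ (doubleWronskian n p φ ψ) := by
  refine contDiff_det fun i c => ?_
  simp only [Matrix.of_apply]
  split_ifs
  · rw [iteratedDeriv_eq_iterate]; exact (hφ i).iterate_deriv _
  · rw [iteratedDeriv_eq_iterate]; exact (hψ i).iterate_deriv _

variable (hφ : ∀ x i, HasDerivAt (fun y => φ y i) (1 / 2 * A.mulVec (φ x) i) x)
  (hψ : ∀ x i, HasDerivAt (fun y => ψ y i) (-(1 / 2 * A.mulVec (ψ x) i)) x)
include hφ hψ

theorem doubleWronskian_eq_det_krylov (x : ℝ) : doubleWronskian n (n + 1) φ ψ x =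
    (∏ j : Fin (n + 1), (1 / 2 : ℂ) ^ (j : ℕ)) * (∏ j : Fin (n + 1), (-(1 / 2) : ℂ) ^ (j : ℕ)) *
      (krylov A (φ x) (ψ x)).det := by
  have hψ' : ∀ x i, HasDerivAt (fun y => ψ y i) (-(1 / 2) * A.mulVec (ψ x) i) x := by
    simpa only [neg_mul] using hψ
  have h : (Matrix.of fun i c : Idx n =>
      if c.pos < n + 1 then iteratedDeriv c.pos (fun y => φ y i) x
      else iteratedDeriv (c.pos - (n + 1)) (fun y => ψ y i) x) =
      krylov A (φ x) (ψ x) * Matrix.diagonal (Sum.elim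
        (fun j : Fin (n + 1) => (1 / 2 : ℂ) ^ (j : ℕ))
        (fun j : Fin (n + 1) => (-(1 / 2) : ℂ) ^ (j : ℕ))) := by
    ext i c
    rw [Matrix.mul_diagonal, Matrix.of_apply, iteratedDeriv_of_linear hφ,
      iteratedDeriv_of_linear hψ']
    rcases c with c | c
    · rw [Idx.pos_inl, if_pos c.isLt, mul_comm]; rfl
    · rw [Idx.pos_inr, if_neg (by omega), Nat.add_sub_cancel_left, mul_comm]; rfl
  rw [doubleWronskian, h, Matrix.det_mul, Matrix.det_diagonal, Fintype.prod_sum_type, mul_comm]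
  rfl

theorem doubleWronskian_eq_det_updateCol (x : ℝ) : doubleWronskian n n φ ψ x =
    (∏ j : Fin n, (1 / 2 : ℂ) ^ (j : ℕ)) * (∏ j : Fin (n + 1), (-(1 / 2) : ℂ) ^ ((j : ℕ) + 1)) *
      ((-1) ^ (n + 1) * ((krylov A (φ x) (ψ x)).updateCol (Sum.inl (Fin.last n))
        ((A ^ (n + 1)).mulVec (ψ x))).det) := by
  have hψ' : ∀ x i, HasDerivAt (fun y => ψ y i) (-(1 / 2) * A.mulVec (ψ x) i) x := by
    simpa only [neg_mul] using hψ
  set U := (krylov A (φ x) (ψ x)).updateCol (Sum.inl (Fin.last n))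
        ((A ^ (n + 1)).mulVec (ψ x)) with hU
  -- Replacing Aⁿφ by Aⁿ⁺¹ψ puts that column in front of ψ, …, Aⁿψ, whereas the Wronskian has it at
  -- the end; `rotateTail` makes up for this. Each derivative contributes ½ or -½, and the entry 1
  -- belongs to the underived column ψ.
  have h : (Matrix.of fun i c : Idx n =>
      if c.pos < n then iteratedDeriv c.pos (fun y => φ y i) x
      else iteratedDeriv (c.pos - n) (fun y => ψ y i) x) =
      U.submatrix id (rotateTail n) * Matrix.diagonal (Sum.elim
        (Fin.snoc (α := fun _ => ℂ) (fun j : Fin n => (1 / 2 : ℂ) ^ (j : ℕ)) 1)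
        (fun j : Fin (n + 1) => (-(1 / 2) : ℂ) ^ ((j : ℕ) + 1))) := by
    ext i c
    rw [Matrix.mul_diagonal, Matrix.of_apply, iteratedDeriv_of_linear hφ,
      iteratedDeriv_of_linear hψ', Matrix.submatrix_apply]
    rcases c with c | c
    · induction c using Fin.lastCases with
      | last => simp [Idx.pos_inl, rotateTail_inl_last, hU, krylov]
      | cast c =>
        simp [Idx.pos_inl, rotateTail_inl_castSucc, hU, krylov,
          Fin.castSucc_ne_last, mul_comm]
    · have e : n + 1 + (c : ℕ) - n = c + 1 := by omega
      have e' : ¬ n + 1 + (c : ℕ) < n := by omega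
      rw [Idx.pos_inr, if_neg e', e, mul_comm]
      induction c using Fin.lastCases with
      | last => simp [rotateTail_inr_last, hU]
      | cast c => simp [rotateTail_inr_castSucc, hU, krylov]
  rw [doubleWronskian, h, Matrix.det_mul, Matrix.det_diagonal, Fintype.prod_sum_type,
    Matrix.det_permute', sign_rotateTail]
  simp only [Sum.elim_inl, Sum.elim_inr, Fin.prod_univ_castSucc (n := n)]
  simp
  ring

/-- The powers of ½ and -½ and the sign of the rotation combine to ½, which the factor 2 cancels, so
the quotient is the (0, 1) entry of `leadMatrix`. -/
theorem two_mul_wronskian_div (x : ℝ) (hf : (krylov A (φ x) (ψ x)).det ≠ 0) :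
    2 * doubleWronskian n n φ ψ x / doubleWronskian n (n + 1) φ ψ x =
      -(1 / 2) * moment A (krylov A (φ x) (ψ x)) 0 0 1 := by
  rw [doubleWronskian_eq_det_krylov hφ hψ, doubleWronskian_eq_det_updateCol hφ hψ,
    (moment_zero_offDiag hf).1, leadMatrix_eq_cramer]
  simp only [pow_succ (-(1 / 2) : ℂ), pow_succ (-1 : ℂ), Finset.prod_mul_distrib,
    Fin.prod_univ_castSucc (n := n),
    Fin.val_castSucc, Fin.val_last, Finset.prod_const, Finset.card_univ, Fintype.card_fin]
  have h1 : (∏ j : Fin n, (1 / 2 : ℂ) ^ (j : ℕ)) ≠ 0 :=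
    Finset.prod_ne_zero_iff.mpr fun j _ => pow_ne_zero _ (by norm_num)
  have h2 : (∏ j : Fin n, (-(1 / 2) : ℂ) ^ (j : ℕ)) ≠ 0 :=
    Finset.prod_ne_zero_iff.mpr fun j _ => pow_ne_zero _ (by norm_num)
  have h3 : (-1 : ℂ) ^ n * (-1) ^ n = 1 := by rw [← mul_pow]; simp
  have h4 : (-(1 / 2) : ℂ) ^ n = (-1) ^ n * (1 / 2) ^ n := by rw [← mul_pow]; norm_num
  have h5 : (1 / 2 : ℂ) ^ n ≠ 0 := pow_ne_zero _ (by norm_num)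
  have h6 : (-1 : ℂ) ^ n ≠ 0 := pow_ne_zero _ (by norm_num)
  rw [h4]
  generalize (1 / 2 : ℂ) ^ n = a at *
  generalize (-1 : ℂ) ^ n = b at *
  field_simp
  linear_combination ((krylov A (φ x) (ψ x)).updateCol (Sum.inl (Fin.last n))
    ((A ^ (n + 1)).mulVec (ψ x))).det * h3

end wronskian

/-! ### Matrix exponentials and the flows of φ and ψ -/

section exponential

theorem hasDerivAt_linear_exp {𝔸 : Type*} [NormedRing 𝔸] [NormedAlgebra ℝ 𝔸] [CompleteSpace 𝔸]
    [FiniteDimensional ℝ 𝔸] (ev : 𝔸 →ₗ[ℝ] ℂ) (M : 𝔸) (s : ℝ) :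
    HasDerivAt (fun y : ℝ => ev (NormedSpace.exp ((y - s) • M))) (ev M) s := by
  have h1 : HasDerivAt (fun u : ℝ => NormedSpace.exp (u • M)) M 0 := by
    simpa using hasDerivAt_exp_smul_const (𝕂 := ℝ) M (0 : ℝ)
  have h2 : HasDerivAt (fun y : ℝ => NormedSpace.exp ((y - s) • M)) M s := by
    have := HasDerivAt.scomp_of_eq s h1 ((hasDerivAt_id s).sub_const s) (by simp)
    simpa [Function.comp_def] using this
  exact (LinearMap.toContinuousLinearMap ev).hasFDerivAt.comp_hasDerivAt s h2

section
attribute [local instance] Matrix.linftyOpNormedRing Matrix.linftyOpNormedAlgebra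

/-- The linear functional makes the conclusion one about a scalar function, so the auxiliary matrix
norm stays inside the proof. -/
theorem hasDerivAt_linear_matrix_exp {ι : Type*} [Fintype ι] [DecidableEq ι]
    (ev : Matrix ι ι ℂ →ₗ[ℝ] ℂ) (M : Matrix ι ι ℂ) (s : ℝ) :
    HasDerivAt (fun y : ℝ => ev (NormedSpace.exp ((y - s) • M))) (ev M) s :=
  hasDerivAt_linear_exp ev M s

theorem hasSum_matrix_exp {ι : Type*} [Fintype ι] [DecidableEq ι] (M : Matrix ι ι ℂ) :
    HasSum (fun k : ℕ => ((k.factorial : ℂ)⁻¹) • M ^ k) (NormedSpace.exp M) :=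
  NormedSpace.exp_series_hasSum_exp' (𝕂 := ℂ) M

end

/-- The increment commutes with E s, so exp(E y) = exp((y - s) M) exp(E s), and the last factor can
be moved into the vector. -/
theorem hasDerivAt_exp_mulVec {ι : Type*} [Fintype ι] [DecidableEq ι] {E : ℝ → Matrix ι ι ℂ}
    {M : Matrix ι ι ℂ} {s : ℝ} (hE : ∀ y, E y = E s + ((y - s : ℝ) : ℂ) • M)
    (hM : Commute M (E s)) (v : ι → ℂ) (i : ι) :
    HasDerivAt (fun y => (NormedSpace.exp (E y)).mulVec v i)
      (M.mulVec ((NormedSpace.exp (E s)).mulVec v) i) s := by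
  let ev : Matrix ι ι ℂ →ₗ[ℝ] ℂ :=
    { toFun := fun N => N.mulVec ((NormedSpace.exp (E s)).mulVec v) i
      map_add' := fun N N' => by rw [Matrix.add_mulVec]; rfl
      map_smul' := fun c N => by rw [Matrix.smul_mulVec]; rfl }
  have h4 : (fun y => (NormedSpace.exp (E y)).mulVec v i) =
      fun y : ℝ => ev (NormedSpace.exp ((y - s) • M)) := by
    funext y
    have hc : Commute ((y - s) • M) (E s) := hM.smul_left _
    have : E y = (y - s) • M + E s := by
      rw [hE y, add_comm]; congr 1
    rw [this, Matrix.exp_add_of_commute _ _ hc, ← Matrix.mulVec_mulVec]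
    rfl
  rw [h4]
  exact hasDerivAt_linear_matrix_exp ev M s

theorem commute_exponent (A : Matrix (Idx n) (Idx n) ℂ) (x : ℝ) (t : Times) :
    Commute A (exponent A x t) := by
  refine ((Commute.refl A).smul_right _).add_right (Commute.smul_right ?_ _)
  exact Commute.tsum_right _ fun j => ((Commute.refl A).pow_right _).smul_right _

/-- Intertwined matrices have intertwined exponentials. -/
theorem exp_mul_of_intertwine {ι κ : Type*} [Fintype ι] [DecidableEq ι] [Fintype κ] [DecidableEq κ]
    {M : Matrix ι ι ℂ} {N : Matrix κ κ ℂ} {S : Matrix ι κ ℂ} (h : M * S = S * N) :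
    NormedSpace.exp M * S = S * NormedSpace.exp N := by
  have hp : ∀ j : ℕ, M ^ j * S = S * N ^ j := by
    intro j
    induction j with
    | zero => simp
    | succ j ih => rw [pow_succ, Matrix.mul_assoc, h, ← Matrix.mul_assoc, ih, Matrix.mul_assoc,
        ← pow_succ]
  have h1 := (hasSum_matrix_exp M).map
    ({ toFun := fun P => P * S, map_zero' := Matrix.zero_mul S,
       map_add' := fun P Q => Matrix.add_mul P Q S } : Matrix ι ι ℂ →+ Matrix ι κ ℂ)
    (continuous_id.matrix_mul continuous_const)
  have h2 := (hasSum_matrix_exp N).map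
    ({ toFun := fun P => S * P, map_zero' := Matrix.mul_zero S,
       map_add' := fun P Q => Matrix.mul_add S P Q } : Matrix κ κ ℂ →+ Matrix ι κ ℂ)
    (continuous_const.matrix_mul continuous_id)
  have e : (fun k : ℕ => (((k.factorial : ℂ)⁻¹) • M ^ k) * S) =
      fun k : ℕ => S * (((k.factorial : ℂ)⁻¹) • N ^ k) :=
    funext fun k => by rw [Matrix.smul_mul, Matrix.mul_smul, hp]
  refine h1.unique (?_ : HasSum (fun k : ℕ => (((k.factorial : ℂ)⁻¹) • M ^ k) * S) _)
  rw [e]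
  exact h2

theorem exp_conjMat {ι : Type} [Fintype ι] [DecidableEq ι] (M : Matrix ι ι ℂ) :
    conjMat (NormedSpace.exp M) = NormedSpace.exp (conjMat M) := by
  have h : ∀ N : Matrix ι ι ℂ, conjMat N = N.conjTransposeᵀ := fun N => rfl
  rw [h, h, Matrix.exp_transpose, Matrix.exp_conjTranspose]

theorem hasDerivAt_phi_space (A : Matrix (Idx n) (Idx n) ℂ) (v : Idx n → ℂ) (x : ℝ) (t : Times)
    (i : Idx n) :
    HasDerivAt (fun y => phi A v y t i) (1 / 2 * A.mulVec (phi A v x t) i) x := by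
  have h := hasDerivAt_exp_mulVec (E := fun y => exponent A y t) (M := (1 / 2 : ℂ) • A) (s := x)
    (fun y => by simp only [exponent, smul_smul]; push_cast; module)
    ((commute_exponent A x t).smul_left _) v i
  refine HasDerivAt.congr_deriv h ?_
  rw [Matrix.smul_mulVec]; rfl

theorem hasDerivAt_psi_space (A : Matrix (Idx n) (Idx n) ℂ) (v : Idx n → ℂ) (x : ℝ) (t : Times)
    (i : Idx n) :
    HasDerivAt (fun y => psi A v y t i) (-(1 / 2 * A.mulVec (psi A v x t) i)) x := by
  have h := hasDerivAt_exp_mulVec (E := fun y => -exponent A y t) (M := -((1 / 2 : ℂ) • A)) (s := x)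
    (fun y => by simp only [exponent]; push_cast; module)
    ((commute_exponent A x t).smul_left _).neg_right.neg_left v i
  refine HasDerivAt.congr_deriv h ?_
  rw [Matrix.neg_mulVec, Matrix.smul_mulVec]; rfl

theorem timeTerm_update (A : Matrix (Idx n) (Idx n) ℂ) (t : Times) (j : ℕ) (s : ℝ) :
    timeTerm A (Function.update t j s) =
      timeTerm A t + Pi.single j (((s - t j : ℝ) : ℂ) • A ^ (2 * (j + 1))) := by
  funext k
  by_cases hk : k = j
  · subst hk
    simp only [timeTerm, Function.update_self, Pi.add_apply, Pi.single_eq_same]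
    push_cast; module
  · simp [timeTerm, hk]

/-- Changing one time alters a single term of the series, so convergence persists and the exponent
is affine in that time. -/
theorem exponent_update {A : Matrix (Idx n) (Idx n) ℂ} {t : Times}
    (h : Summable (timeTerm A t)) (x : ℝ) (j : ℕ) (s : ℝ) :
    exponent A x (Function.update t j s) =
      exponent A x t + ((s - t j : ℝ) : ℂ) • (Complex.I / 2) • A ^ (2 * (j + 1)) := by
  have e : ∑' k, timeTerm A (Function.update t j s) k =
      ∑' k, timeTerm A t k + ((s - t j : ℝ) : ℂ) • A ^ (2 * (j + 1)) := by
    rw [timeTerm_update]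
    exact (h.hasSum.add (hasSum_pi_single j _)).tsum_eq
  rw [exponent, exponent, e]
  module

theorem hasDerivAt_phi_time {A : Matrix (Idx n) (Idx n) ℂ} {t : Times}
    (h : Summable (timeTerm A t)) (v : Idx n → ℂ) (x : ℝ) (j : ℕ) (i : Idx n) :
    HasDerivAt (fun s => phi A v x (Function.update t j s) i)
      (Complex.I / 2 * (A ^ (2 * (j + 1))).mulVec (phi A v x t) i) (t j) := by
  have h := hasDerivAt_exp_mulVec (E := fun s => exponent A x (Function.update t j s))
    (M := (Complex.I / 2) • A ^ (2 * (j + 1))) (s := t j)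
    (fun y => by simp only [Function.update_eq_self]; exact exponent_update h x j y)
    (((commute_exponent A x _).pow_left _).smul_left _) v i
  refine HasDerivAt.congr_deriv h ?_
  rw [Function.update_eq_self, Matrix.smul_mulVec]; rfl

theorem hasDerivAt_psi_time {A : Matrix (Idx n) (Idx n) ℂ} {t : Times}
    (h : Summable (timeTerm A t)) (v : Idx n → ℂ) (x : ℝ) (j : ℕ) (i : Idx n) :
    HasDerivAt (fun s => psi A v x (Function.update t j s) i)
      (-(Complex.I / 2 * (A ^ (2 * (j + 1))).mulVec (psi A v x t) i)) (t j) := by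
  have h := hasDerivAt_exp_mulVec (E := fun s => -exponent A x (Function.update t j s))
    (M := -((Complex.I / 2) • A ^ (2 * (j + 1)))) (s := t j)
    (fun y => by
      simp only [Function.update_eq_self]
      rw [exponent_update h x j y]
      module)
    (((commute_exponent A x _).pow_left _).smul_left _).neg_right.neg_left v i
  refine HasDerivAt.congr_deriv h ?_
  rw [Function.update_eq_self, Matrix.neg_mulVec, Matrix.smul_mulVec]; rfl

end exponential

/-! ### The reduction r(x) = δ q*(σx) -/

section reduction

variable {σ δ : ℝ} {A T : Matrix (Idx n) (Idx n) ℂ}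

theorem conjMat_pow {ι : Type} [Fintype ι] [DecidableEq ι] (M : Matrix ι ι ℂ) (j : ℕ) :
    conjMat (M ^ j) = conjMat M ^ j :=
  Matrix.map_pow M (starRingEnd ℂ) j

theorem conjVec_mulVec (M : Matrix (Idx n) (Idx n) ℂ) (v : Idx n → ℂ) :
    conjVec (M.mulVec v) = (conjMat M).mulVec (conjVec v) := by
  funext i
  simp [conjVec, conjMat, Matrix.mulVec, dotProduct, map_sum]

theorem conjVec_conjVec (v : Idx n → ℂ) : conjVec (conjVec v) = v := by
  funext i; simp [conjVec]

theorem Compatible.mul_conjMat (h : Compatible σ δ A T) (hσ : σ = 1 ∨ σ = -1) :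
    T * conjMat A = (-(σ : ℂ) • A) * T := by
  have h1 := h.1
  have hs : (σ : ℂ) * σ = 1 := by rcases hσ with rfl | rfl <;> simp
  have h2 : T * conjMat A = (σ : ℂ) • ((σ : ℂ) • (T * conjMat A)) := by
    rw [smul_smul, hs, one_smul]
  rw [h2, eq_neg_of_add_eq_zero_right h1, Matrix.smul_mul]
  simp

theorem Compatible.mul_conjMat_pow (h : Compatible σ δ A T) (hσ : σ = 1 ∨ σ = -1) (j : ℕ) :
    T * conjMat A ^ j = (-(σ : ℂ)) ^ j • (A ^ j * T) := by
  have h1 : ∀ j : ℕ, T * conjMat A ^ j = (-(σ : ℂ) • A) ^ j * T := by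
    intro j
    induction j with
    | zero => simp
    | succ j ih => rw [pow_succ, ← Matrix.mul_assoc, ih, Matrix.mul_assoc, h.mul_conjMat hσ,
        ← Matrix.mul_assoc, ← pow_succ]
  rw [h1, smul_pow, Matrix.smul_mul]

/-- The symmetry of the exponents. -/
theorem Compatible.mul_conjMat_exponent (h : Compatible σ δ A T) (hσ : σ = 1 ∨ σ = -1)
    {t : Times} (ht : Summable (timeTerm A t)) (x : ℝ) :
    T * conjMat (exponent A (σ * x) t) = -exponent A x t * T := by
  have hs : (σ : ℂ) * σ = 1 := by rcases hσ with rfl | rfl <;> simp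
  have hterm : ∀ j, T * conjMat (timeTerm A t j) = timeTerm A t j * T := by
    intro j
    have h1 : conjMat (timeTerm A t j) = (t j : ℂ) • conjMat A ^ (2 * (j + 1)) := by
      rw [← conjMat_pow]
      ext a b
      simp [timeTerm, conjMat]
    -- Only even powers of A occur, so the signs -σ from moving A past T disappear.
    have h2 : (-(σ : ℂ)) ^ (2 * (j + 1)) = 1 := by
      rw [pow_mul, neg_sq, pow_two, hs, one_pow]
    rw [h1, Matrix.mul_smul, h.mul_conjMat_pow hσ, h2, one_smul, timeTerm, Matrix.smul_mul]
  have h1 := ht.hasSum.map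
    ({ toFun := fun P => T * conjMat P
       map_zero' := by simp [conjMat]
       map_add' := fun P Q => by
        rw [← Matrix.mul_add]; congr 1; ext a b; simp [conjMat] } :
      Matrix (Idx n) (Idx n) ℂ →+ Matrix (Idx n) (Idx n) ℂ)
    (continuous_const.matrix_mul (continuous_id.matrix_map Complex.continuous_conj))
  have h2 := ht.hasSum.map
    ({ toFun := fun P => P * T, map_zero' := Matrix.zero_mul T,
       map_add' := fun P Q => Matrix.add_mul P Q T } :
      Matrix (Idx n) (Idx n) ℂ →+ Matrix (Idx n) (Idx n) ℂ)
    (continuous_id.matrix_mul continuous_const)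
  have h3 : T * conjMat (∑' j, timeTerm A t j) = (∑' j, timeTerm A t j) * T := by
    have e : (fun j => T * conjMat (timeTerm A t j)) = fun j => timeTerm A t j * T := funext hterm
    refine h1.unique (?_ : HasSum (fun j => T * conjMat (timeTerm A t j)) _)
    rw [e]
    exact h2
  -- The total sign -1 arises in the time part from the conjugate of i/2, and in the space part from
  -- σ · (-σ).
  have h4 : conjMat (exponent A (σ * x) t) = ((σ : ℂ) * x / 2) • conjMat A +
      (-(Complex.I / 2)) • conjMat (∑' j, timeTerm A t j) := by
    ext a b
    simp [exponent, conjMat, map_ofNat]; ring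
  have h5 := h.mul_conjMat hσ
  have h6 : (σ : ℂ) * x / 2 * -σ = -(x / 2) := by linear_combination (-(x : ℂ) / 2) * hs
  rw [h4, Matrix.mul_add, Matrix.mul_smul, Matrix.mul_smul, h3, h5, exponent, Matrix.smul_mul,
    smul_smul, h6, Matrix.neg_mul, Matrix.add_mul, Matrix.smul_mul, Matrix.smul_mul]
  module

/-- T intertwines the conjugate exponent at σx with minus the exponent at x, hence also their
exponentials. -/
theorem Compatible.psi_eq_reflected (h : Compatible σ δ A T) (hσ : σ = 1 ∨ σ = -1)
    {t : Times} (ht : Summable (timeTerm A t)) (v : Idx n → ℂ) (x : ℝ) :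
    psi A (T.mulVec (conjVec v)) x t = reflected σ T (phi A v) x t := by
  rw [psi, reflected, phi, conjVec_mulVec, exp_conjMat, Matrix.mulVec_mulVec, Matrix.mulVec_mulVec,
    exp_mul_of_intertwine (h.mul_conjMat_exponent hσ ht x).symm]

end reduction

section reduction

variable {σ δ : ℝ} {A T : Matrix (Idx n) (Idx n) ℂ}

/-- The matrix relating the Krylov matrix at `x` with the conjugate of the one at `σ x`. -/
noncomputable def swapMat (n : ℕ) (s ε : ℂ) : Matrix (Idx n) (Idx n) ℂ :=
  Matrix.fromBlocks 0 (ε • Matrix.diagonal fun j : Fin (n + 1) => s ^ (j : ℕ))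
    (Matrix.diagonal fun j : Fin (n + 1) => s ^ (j : ℕ)) 0

theorem mul_swapMat_inl {ι : Type*} (M : Matrix ι (Idx n) ℂ) (s ε : ℂ) (i : ι) (j : Fin (n + 1)) :
    (M * swapMat n s ε) i (Sum.inl j) = M i (Sum.inr j) * s ^ (j : ℕ) := by
  simp [Matrix.mul_apply, swapMat, Matrix.diagonal_apply]

theorem mul_swapMat_inr {ι : Type*} (M : Matrix ι (Idx n) ℂ) (s ε : ℂ) (i : ι) (j : Fin (n + 1)) :
    (M * swapMat n s ε) i (Sum.inr j) = M i (Sum.inl j) * (ε * s ^ (j : ℕ)) := by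
  simp [Matrix.mul_apply, swapMat, Matrix.diagonal_apply]

theorem swapMat_mul_self {s ε : ℂ} (hs : s * s = 1) :
    swapMat n s ε * swapMat n s ε = ε • (1 : Matrix (Idx n) (Idx n) ℂ) := by
  have h : (Matrix.diagonal fun j : Fin (n + 1) => s ^ (j : ℕ)) *
      (Matrix.diagonal fun j : Fin (n + 1) => s ^ (j : ℕ)) = 1 := by
    rw [Matrix.diagonal_mul_diagonal, ← Matrix.diagonal_one]
    congr 1; funext j; rw [← mul_pow, hs, one_pow]
  rw [swapMat, Matrix.fromBlocks_multiply]
  simp [h, ← Matrix.fromBlocks_one, Matrix.fromBlocks_smul]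

theorem det_swapMat_ne_zero {s ε : ℂ} (hs : s * s = 1) (hε : ε ≠ 0) : (swapMat n s ε).det ≠ 0 := by
  intro h
  have h1 := congrArg Matrix.det (swapMat_mul_self (n := n) (ε := ε) hs)
  rw [Matrix.det_mul, h, Matrix.det_smul, Matrix.det_one, zero_mul, mul_one] at h1
  exact pow_ne_zero _ hε h1.symm

theorem swapMat_mul_lastCols (s ε : ℂ) :
    swapMat n s ε * lastCols n = lastCols n * (s ^ n • !![0, ε; 1, 0]) := by
  ext i c
  rw [mul_lastCols_apply, Matrix.mul_apply, Fin.sum_univ_two]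
  rcases i with i | i <;> fin_cases c <;> by_cases hi : i = Fin.last n <;>
    simp [swapMat, lastCols, hi, mul_comm]

theorem lastCols_transpose_mul_swapMat (s ε : ℂ) :
    (lastCols n)ᵀ * swapMat n s ε = (s ^ n • !![0, ε; 1, 0]) * (lastCols n)ᵀ := by
  ext c i
  rw [lastCols_transpose_mul_apply, Matrix.mul_apply, Fin.sum_univ_two]
  rcases i with i | i <;> fin_cases c <;> by_cases hi : Fin.last n = i
  all_goals first
    | (subst hi; simp [swapMat, lastCols, mul_comm])
    | simp [swapMat, lastCols, hi, Ne.symm hi]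

theorem Compatible.det_ne_zero (h : Compatible σ δ A T) (hε : δ * σ ≠ 0) : T.det ≠ 0 := by
  intro h0
  have h1 := congrArg Matrix.det h.2
  rw [Matrix.det_mul, h0, zero_mul, Matrix.det_smul, Matrix.det_one, mul_one] at h1
  exact pow_ne_zero _ (by exact_mod_cast hε) h1.symm

theorem Compatible.mul_conjMat_krylov (h : Compatible σ δ A T) (hσ : σ = 1 ∨ σ = -1)
    {a b a' b' : Idx n → ℂ} (hb : b = T.mulVec (conjVec a'))
    (hb' : b' = T.mulVec (conjVec a)) :
    T * conjMat (krylov A a' b') = krylov A a b * swapMat n (-(σ : ℂ)) ((δ * σ : ℝ) : ℂ) := by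
  have key : ∀ (v : Idx n → ℂ) (j : ℕ),
      T.mulVec (conjVec ((A ^ j).mulVec v)) =
        (-(σ : ℂ)) ^ j • (A ^ j).mulVec (T.mulVec (conjVec v)) := by
    intro v j
    rw [conjVec_mulVec, conjMat_pow, Matrix.mulVec_mulVec, h.mul_conjMat_pow hσ,
      Matrix.smul_mulVec, Matrix.mulVec_mulVec]
  -- Reflecting twice produces T T* = δσ I; this is why the factor δσ stands in only one block of
  -- `swapMat`.
  have ha : T.mulVec (conjVec b') = ((δ * σ : ℝ) : ℂ) • a := by
    rw [hb', conjVec_mulVec, conjVec_conjVec, Matrix.mulVec_mulVec, h.2, Matrix.smul_mulVec,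
      Matrix.one_mulVec]
  ext i c
  rcases c with j | j
  · rw [mul_swapMat_inl]
    refine (congrFun (key a' j) i).trans ?_
    rw [← hb, mul_comm]; rfl
  · rw [mul_swapMat_inr]
    refine (congrFun (key b' j) i).trans ?_
    rw [ha, Matrix.mulVec_smul, Pi.smul_apply, Pi.smul_apply, smul_eq_mul, smul_eq_mul]
    change _ = (A ^ (j : ℕ)).mulVec a i * _
    ring

theorem conjMat_leadMatrix (A B : Matrix (Idx n) (Idx n) ℂ) :
    conjMat (leadMatrix A B) =
      (leadCoords B).map (starRingEnd ℂ) * (conjMat A * (conjMat B * lastCols n)) := by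
  have hE : (lastCols n).map (starRingEnd ℂ) = lastCols n := by
    ext i c; simp [lastCols, apply_ite (starRingEnd ℂ)]
  change (leadMatrix A B).map (starRingEnd ℂ) = _
  rw [leadMatrix, Matrix.map_mul, Matrix.map_mul, Matrix.map_mul, hE]
  rfl

theorem conj_leadCoords_mul {B : Matrix (Idx n) (Idx n) ℂ} (hB : IsUnit B.det) :
    (leadCoords B).map (starRingEnd ℂ) * conjMat B = (lastCols n)ᵀ := by
  have hE : ((lastCols n)ᵀ).map (starRingEnd ℂ) = (lastCols n)ᵀ := by
    ext i c; simp [lastCols, apply_ite (starRingEnd ℂ)]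
  have hc : conjMat B = B.map (starRingEnd ℂ) := rfl
  rw [hc, ← Matrix.map_mul, leadCoords_mul_basis hB, hE]

variable (h : Compatible σ δ A T) (hσ : σ = 1 ∨ σ = -1) (hδ : δ = 1 ∨ δ = -1)
    {a b a' b' : Idx n → ℂ} (hb : b = T.mulVec (conjVec a'))
    (hb' : b' = T.mulVec (conjVec a))
include h hσ hδ hb hb'

/-- The value r(x) involves q at σx, so the denominators at the two points have to vanish together;
they do because T and `swapMat` are invertible. -/
theorem Compatible.det_krylov_ne_zero_iff :
    (krylov A a' b').det ≠ 0 ↔ (krylov A a b).det ≠ 0 := by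
  have hε : δ * σ ≠ 0 := by rcases hσ with rfl | rfl <;> rcases hδ with rfl | rfl <;> norm_num
  have hs : (-(σ : ℂ)) * -σ = 1 := by rcases hσ with rfl | rfl <;> simp
  have h1 := congrArg Matrix.det (h.mul_conjMat_krylov hσ hb hb')
  have h2 : (conjMat (krylov A a' b')).det = conj ((krylov A a' b').det) :=
    (RingHom.map_det (starRingEnd ℂ) _).symm
  have h3 := det_swapMat_ne_zero (n := n) (ε := ((δ * σ : ℝ) : ℂ)) hs (by exact_mod_cast hε)
  have h4 := h.det_ne_zero hε
  rw [Matrix.det_mul, Matrix.det_mul, h2] at h1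
  constructor
  · intro h0 h5
    rw [h5, zero_mul] at h1
    rcases mul_eq_zero.mp h1 with h6 | h6
    · exact h4 h6
    · exact h0 (by simpa using h6)
  · intro h0 h5
    rw [h5, map_zero, mul_zero] at h1
    exact mul_ne_zero h0 h3 h1.symm

/-- The reflection symmetry of the off-diagonal coordinates. -/
theorem Compatible.conj_leadMatrix (hB : (krylov A a b).det ≠ 0) :
    (δ : ℂ) * conj (leadMatrix A (krylov A a' b') 0 1) = -leadMatrix A (krylov A a b) 1 0 := by
  have hB' := (h.det_krylov_ne_zero_iff hσ hδ hb hb').mpr hB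
  set B := krylov A a b with hBdef
  set B' := krylov A a' b' with hBdef'
  set s : ℂ := -(σ : ℂ) with hs
  set ε : ℂ := ((δ * σ : ℝ) : ℂ) with hε
  set P := swapMat n s ε with hP
  have hTB : T * conjMat B' = B * P := h.mul_conjMat_krylov hσ hb hb'
  set π : Matrix (Fin 2) (Fin 2) ℂ := s ^ n • !![0, ε; 1, 0] with hπ
  have hs1 : s ^ n ≠ 0 := by
    refine pow_ne_zero _ ?_
    rcases hσ with rfl | rfl <;> simp [hs]
  set l' := (leadCoords B').map (starRingEnd ℂ) with hl'
  have hl'B : l' * conjMat B' = (lastCols n)ᵀ := conj_leadCoords_mul (isUnit_iff_ne_zero.mpr hB')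
  have hu : IsUnit (conjMat B').det := by
    have h2 : (conjMat B').det = conj (B'.det) := (RingHom.map_det (starRingEnd ℂ) _).symm
    rw [h2, isUnit_iff_ne_zero]; simpa using hB'
  have h1 : π * l' = leadCoords B * T := by
    have h2 : π * l' * conjMat B' = leadCoords B * T * conjMat B' := by
      rw [Matrix.mul_assoc, hl'B, Matrix.mul_assoc, hTB, ← Matrix.mul_assoc,
        leadCoords_mul_basis (isUnit_iff_ne_zero.mpr hB), lastCols_transpose_mul_swapMat]
    have h3 := congrArg (· * (conjMat B')⁻¹) h2
    simpa only [Matrix.mul_assoc, mul_nonsing_inv _ hu, Matrix.mul_one] using h3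
  have h2 : π * conjMat (leadMatrix A B') = s • (leadMatrix A B * π) := by
    calc π * conjMat (leadMatrix A B') = π * l' * (conjMat A * (conjMat B' * lastCols n)) := by
          rw [conjMat_leadMatrix, Matrix.mul_assoc]
      _ = leadCoords B * (T * conjMat A) * (conjMat B' * lastCols n) := by
          rw [h1]; simp only [Matrix.mul_assoc]
      _ = s • (leadCoords B * A * (T * conjMat B') * lastCols n) := by
          rw [h.mul_conjMat hσ]
          simp only [Matrix.mul_assoc, Matrix.smul_mul, Matrix.mul_smul, ← hs]
      _ = s • (leadCoords B * A * B * (P * lastCols n)) := by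
          rw [hTB]; simp only [Matrix.mul_assoc]
      _ = s • (leadMatrix A B * π) := by
          rw [hP, swapMat_mul_lastCols, leadMatrix]; simp only [Matrix.mul_assoc]; rfl
  -- As π is off-diagonal, this entry contains only the (0, 1) coordinate at the reflected point and
  -- the (1, 0) coordinate at the original one.
  have h3 := congrFun (congrFun h2 1) 1
  have h4 : conjMat (leadMatrix A B') 0 1 = conj (leadMatrix A B' 0 1) := rfl
  simp only [hπ, Matrix.mul_smul, Matrix.smul_apply, Matrix.mul_apply,
    Fin.sum_univ_two, Matrix.of_apply, Matrix.cons_val_zero, Matrix.cons_val_one,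
    Matrix.cons_val_fin_one, smul_eq_mul, h4] at h3
  have h5 : s ^ n * (conj (leadMatrix A B' 0 1) - s * ε * leadMatrix A B 1 0) = 0 := by
    linear_combination h3
  have h6 := (mul_eq_zero.mp h5).resolve_left hs1
  have h7 : (δ : ℂ) * s * ε = -1 := by
    rcases hσ with rfl | rfl <;> rcases hδ with rfl | rfl <;> simp [hs, hε]
  linear_combination (δ : ℂ) * h6 + leadMatrix A B 1 0 * h7

end reduction

/-! ### The Wronskian quotient solves the hierarchy -/

section solution

variable {σ δ : ℝ} {A T : Matrix (Idx n) (Idx n) ℂ}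

theorem tauF_ne_zero_iff (A : Matrix (Idx n) (Idx n) ℂ) (v w : Idx n → ℂ) (x : ℝ) (t : Times) :
    tauF (phi A v) (psi A w) x t ≠ 0 ↔ (krylov A (phi A v x t) (psi A w x t)).det ≠ 0 := by
  rw [tauF, doubleWronskian_eq_det_krylov (A := A) (fun x i => hasDerivAt_phi_space A v x t i)
    (fun x i => hasDerivAt_psi_space A w x t i), mul_ne_zero_iff]
  refine and_iff_right (mul_ne_zero ?_ ?_) <;>
    exact Finset.prod_ne_zero_iff.mpr fun j _ => pow_ne_zero _ (by norm_num)

theorem wronskianQ_eq_moment {v w : Idx n → ℂ} {x : ℝ} {t : Times}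
    (h : (krylov A (phi A v x t) (psi A w x t)).det ≠ 0) :
    wronskianQ (phi A v) (psi A w) x t =
      -(1 / 2) * moment A (krylov A (phi A v x t) (psi A w x t)) 0 0 1 :=
  two_mul_wronskian_div (A := A) (fun x i => hasDerivAt_phi_space A v x t i)
    (fun x i => hasDerivAt_psi_space A w x t i) x h

theorem contDiffAt_wronskianQ {v w : Idx n → ℂ} {x : ℝ} {t : Times}
    (h : (krylov A (phi A v x t) (psi A w x t)).det ≠ 0) :
    ContDiffAt ℝ ∞ (fun y => wronskianQ (phi A v) (psi A w) y t) x := by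
  have hφ : ∀ i, ContDiff ℝ ∞ fun y => phi A v y t i :=
    contDiff_of_linear fun x i => hasDerivAt_phi_space A v x t i
  have hψ : ∀ i, ContDiff ℝ ∞ fun y => psi A w y t i :=
    contDiff_of_linear (A := A) (κ := -(1 / 2)) fun x i => by
      simpa only [neg_mul] using hasDerivAt_psi_space A w x t i
  have h1 : ContDiffAt ℝ ∞ (doubleWronskian n n (fun y => phi A v y t) fun y => psi A w y t) x :=
    (contDiff_doubleWronskian hφ hψ n).contDiffAt
  have h2 : ContDiffAt ℝ ∞
      (doubleWronskian n (n + 1) (fun y => phi A v y t) fun y => psi A w y t) x :=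
    (contDiff_doubleWronskian hφ hψ (n + 1)).contDiffAt
  have h3 : doubleWronskian n (n + 1) (fun y => phi A v y t) (fun y => psi A w y t) x ≠ 0 :=
    (tauF_ne_zero_iff A v w x t).mpr h
  have h4 : ContDiffAt ℝ ∞ (fun _ : ℝ => (2 : ℂ)) x := contDiffAt_const
  exact ((h4.mul h1).mul (h2.inv h3)).congr_of_eventuallyEq
    (Filter.Eventually.of_forall fun y => div_eq_mul_inv _ _)

theorem isOpen_tauF_ne_zero (A : Matrix (Idx n) (Idx n) ℂ) (v w : Idx n → ℂ) (t : Times) :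
    IsOpen {x | tauF (phi A v) (psi A w) x t ≠ 0} := by
  have hφ : ∀ i, ContDiff ℝ ∞ fun y => phi A v y t i :=
    contDiff_of_linear fun x i => hasDerivAt_phi_space A v x t i
  have hψ : ∀ i, ContDiff ℝ ∞ fun y => psi A w y t i :=
    contDiff_of_linear (A := A) (κ := -(1 / 2)) fun x i => by
      simpa only [neg_mul] using hasDerivAt_psi_space A w x t i
  exact isOpen_ne_fun (contDiff_doubleWronskian hφ hψ (n + 1)).continuous continuous_const

theorem hasDerivAt_wronskianQ_time {v w : Idx n → ℂ} {x : ℝ} {t : Times}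
    (ht : Summable (timeTerm A t)) (h : (krylov A (phi A v x t) (psi A w x t)).det ≠ 0) (j : ℕ) :
    HasDerivAt (fun s => wronskianQ (phi A v) (psi A w) x (Function.update t j s))
      (Complex.I / 2 * moment A (krylov A (phi A v x t) (psi A w x t)) (2 * (j + 1)) 0 1)
      (t j) := by
  have hφ := hasDerivAt_phi_time ht v x j
  have hψ := hasDerivAt_psi_time ht w x j
  have e : Function.update t j (t j) = t := Function.update_eq_self j t
  set φ : ℝ → Idx n → ℂ := fun s => phi A v x (Function.update t j s) with hφdef
  set ψ : ℝ → Idx n → ℂ := fun s => psi A w x (Function.update t j s) with hψdef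
  have hφe : φ (t j) = phi A v x t := by simp [hφdef]
  have hψe : ψ (t j) = psi A w x t := by simp [hψdef]
  rw [← hφe] at hφ
  rw [← hψe] at hψ
  rw [← hφe, ← hψe] at h ⊢
  have hm := (hasDerivAt_moment_zero h hφ hψ).const_mul (-(1 / 2))
  have hK := HasEntryDerivAt.krylov (A := A) hφ hψ
  have hc : ContinuousAt (fun s => (krylov A (φ s) (ψ s)).det) (t j) :=
    (HasEntryDerivAt.differentiableAt_det fun a b => (hK a b).differentiableAt).continuousAt
  refine (hm.congr_of_eventuallyEq ?_).congr_deriv (by ring)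
  filter_upwards [hc.eventually_ne h] with s hs using wronskianQ_eq_moment hs

/-- On the open set where the denominator is nonzero, the entries of the moments satisfy the
hypotheses of `evalAt_K_of_recursion`. The time derivative of q is i/2 times the moment entry equal
to 2 K_{1,2l}, and i · i = -1 gives the equation. -/
theorem Compatible.solvesNLSI (h : Compatible σ δ A T) (hσ : σ = 1 ∨ σ = -1)
    (hδ : δ = 1 ∨ δ = -1) (v : Idx n → ℂ) {t : Times} (ht : Summable (timeTerm A t)) {x : ℝ}
    (hf : tauF (phi A v) (psi A (T.mulVec (conjVec v))) x t ≠ 0) :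
    SolvesNLSI σ δ (wronskianQ (phi A v) (psi A (T.mulVec (conjVec v)))) x t := by
  set w := T.mulVec (conjVec v) with hw
  set Q := wronskianQ (phi A v) (psi A w) with hQ
  set B : ℝ → Matrix (Idx n) (Idx n) ℂ := fun y => krylov A (phi A v y t) (psi A w y t) with hBdef
  set S : Set ℝ := {x | tauF (phi A v) (psi A w) x t ≠ 0} with hSdef
  have hS : IsOpen S := isOpen_tauF_ne_zero A v w t
  have hB : ∀ y ∈ S, (B y).det ≠ 0 := fun y hy => (tauF_ne_zero_iff A v w y t).mp hy
  have hψ : ∀ y, psi A w y t = T.mulVec (conjVec (phi A v (σ * y) t)) :=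
    fun y => h.psi_eq_reflected hσ ht v y
  have hψ' : ∀ y, psi A w (σ * y) t = T.mulVec (conjVec (phi A v y t)) := by
    intro y
    have : σ * (σ * y) = y := by rcases hσ with rfl | rfl <;> ring
    rw [hψ, this]
  have hB' : ∀ y ∈ S, (B (σ * y)).det ≠ 0 := fun y hy =>
    (h.det_krylov_ne_zero_iff hσ hδ (hψ y) (hψ' y)).mpr (hB y hy)
  have hq : ∀ y ∈ S, ContDiffAt ℝ ∞ (fun y => Q y t) y := fun y hy =>
    contDiffAt_wronskianQ (hB y hy)
  have hr : ∀ y ∈ S, ContDiffAt ℝ ∞ (fun y => reducedR σ δ Q y t) y := fun y hy => by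
    have h1 : ContDiffAt ℝ ∞ (fun y => Q y t) (σ * y) := contDiffAt_wronskianQ (hB' y hy)
    have h2 : ContDiffAt ℝ ∞ (fun y => Q (σ * y) t) y :=
      h1.comp (f := fun y => σ * y) y (contDiffAt_const.mul contDiffAt_id)
    exact contDiffAt_const.mul (Complex.conjCLE.contDiff.contDiffAt.comp y h2)
  have hq0 : ∀ y ∈ S, Q y t = -(1 / 2) * moment A (B y) 0 0 1 := fun y hy =>
    wronskianQ_eq_moment (hB y hy)
  have hr0 : ∀ y ∈ S, reducedR σ δ Q y t = -(1 / 2) * moment A (B y) 0 1 0 := fun y hy => by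
    have h1 : Q (σ * y) t = leadMatrix A (B (σ * y)) 0 1 := by
      rw [hQ, wronskianQ_eq_moment (hB' y hy), (moment_zero_offDiag (hB' y hy)).1]
      ring
    rw [reducedR, h1, (moment_zero_offDiag (hB y hy)).2,
      h.conj_leadMatrix hσ hδ (hψ y) (hψ' y) (hB y hy)]
    ring
  have hm := fun j y hy => hasDerivAt_moment_space (A := A) (φ := fun y => phi A v y t)
    (ψ := fun y => psi A w y t) (s := y) (hB y hy) (hasDerivAt_phi_space A v y t)
    (hasDerivAt_psi_space A w y t) j
  have key := evalAt_K_of_recursion hS (u := fun y => Q y t) (v := fun y => reducedR σ δ Q y t)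
    (a := fun j y => moment A (B y) j 0 0) (b := fun j y => moment A (B y) j 0 1)
    (c := fun j y => moment A (B y) j 1 0) hq hr hq0 hr0 (fun j y hy => (hm j y hy).1)
    (fun j y hy => (hm j y hy).2) (fun j y hy => (moment_diag (hB y hy) j).2)
  refine ⟨hq x hf, hr x hf, fun j => ⟨_, hasDerivAt_wronskianQ_time ht (hB x hf) j, ?_⟩⟩
  rw [(key (2 * (j + 1)) x hf).1]
  linear_combination (moment A (B x) (2 * (j + 1)) 0 1 / 2) * Complex.I_mul_I

end solution

/-! ### The explicit matrices and the passage to an explicit φ -/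

theorem tableA_tableT_compatible {σ δ : ℝ} (hσ : σ = 1 ∨ σ = -1) (hδ : δ = 1 ∨ δ = -1)
    (M : Matrix (Fin (n + 1)) (Fin (n + 1)) ℂ) :
    Compatible σ δ (tableA σ M) (tableT n σ δ) := by
  have hc : ∀ M : Matrix (Fin (n + 1)) (Fin (n + 1)) ℂ, conjMat (conjMat M) = M := by
    intro M; ext i j; simp [conjMat]
  have hn : ∀ M : Matrix (Fin (n + 1)) (Fin (n + 1)) ℂ, conjMat (-M) = -conjMat M := by
    intro M; ext i j; simp [conjMat]
  have h0 : conjMat (0 : Matrix (Fin (n + 1)) (Fin (n + 1)) ℂ) = 0 := by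
    ext i j; simp [conjMat]
  have h1 : conjMat (1 : Matrix (Fin (n + 1)) (Fin (n + 1)) ℂ) = 1 :=
    Matrix.map_one _ (map_zero _) (map_one _)
  have hb : ∀ a b c d : Matrix (Fin (n + 1)) (Fin (n + 1)) ℂ,
      conjMat (Matrix.fromBlocks a b c d) =
        Matrix.fromBlocks (conjMat a) (conjMat b) (conjMat c) (conjMat d) :=
    fun a b c d => Matrix.fromBlocks_map a b c d _
  have hne : ¬ (-1 : ℝ) = 1 := by norm_num
  have hne' : ¬ (1 : ℝ) = -1 := by norm_num
  rcases hσ with rfl | rfl <;> rcases hδ with rfl | rfl <;>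
    simp [Compatible, tableA, tableT, hb, hc, hn, h0, h1, hne, hne', Matrix.fromBlocks_multiply,
      Matrix.fromBlocks_add, Matrix.fromBlocks_neg,
      ← Matrix.fromBlocks_one]

/-- The solutions only depend on the values of the vector `φ` at the times considered. -/
theorem Compatible.solvesNLSI_of_eq {σ δ : ℝ} {A T : Matrix (Idx n) (Idx n) ℂ}
    (h : Compatible σ δ A T) (hσ : σ = 1 ∨ σ = -1)
    (hδ : δ = 1 ∨ δ = -1) (v : Idx n → ℂ) {φ : ℝ → Times → Idx n → ℂ} {G : Times → Prop}
    (hG : ∀ t, G t → ∀ j s, G (Function.update t j s))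
    (hsum : ∀ t, G t → Summable (timeTerm A t))
    (hφ : ∀ t, G t → ∀ x, phi A v x t = φ x t) {t : Times} (ht : G t) {x : ℝ}
    (hf : tauF φ (reflected σ T φ) x t ≠ 0) :
    SolvesNLSI σ δ (wronskianQ φ (reflected σ T φ)) x t := by
  set w := T.mulVec (conjVec v) with hw
  have e1 : ∀ t, G t → (fun y => φ y t) = fun y => phi A v y t := fun t ht =>
    funext fun y => (hφ t ht y).symm
  have e2 : ∀ t, G t → (fun y => reflected σ T φ y t) = fun y => psi A w y t := fun t ht => by
    funext y
    rw [hw, h.psi_eq_reflected hσ (hsum t ht), reflected, reflected, hφ t ht]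
  have e3 : ∀ t, G t → ∀ x, tauF φ (reflected σ T φ) x t = tauF (phi A v) (psi A w) x t :=
    fun t ht x => by rw [tauF, tauF, e1 t ht, e2 t ht]
  have e4 : ∀ t, G t → ∀ x,
      wronskianQ φ (reflected σ T φ) x t = wronskianQ (phi A v) (psi A w) x t :=
    fun t ht x => by rw [wronskianQ, wronskianQ, e3 t ht, e1 t ht, e2 t ht]
  rw [e3 t ht] at hf
  obtain ⟨h1, h2, h3⟩ := h.solvesNLSI hσ hδ v (hsum t ht) hf
  have e5 : (fun y => wronskianQ φ (reflected σ T φ) y t) =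
      fun y => wronskianQ (phi A v) (psi A w) y t := funext fun y => e4 t ht y
  have e6 : (fun y => reducedR σ δ (wronskianQ φ (reflected σ T φ)) y t) =
      fun y => reducedR σ δ (wronskianQ (phi A v) (psi A w)) y t :=
    funext fun y => by rw [reducedR, reducedR, e4 t ht]
  refine ⟨e5 ▸ h1, e6 ▸ h2, fun j => ?_⟩
  obtain ⟨q', h4, h5⟩ := h3 j
  -- The time derivative involves φ at the changed times; this is where the stability of G under
  -- changing one entry is needed.
  have e7 : (fun s => wronskianQ φ (reflected σ T φ) x (Function.update t j s)) =
      fun s => wronskianQ (phi A v) (psi A w) x (Function.update t j s) :=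
    funext fun s => e4 _ (hG t ht j s) x
  exact ⟨q', e7 ▸ h4, by rw [e5, e6]; exact h5⟩

theorem summable_update {f : ℕ → ℂ} {t : Times} (h : Summable fun j => f j * (t j : ℂ)) (j : ℕ)
    (s : ℝ) : Summable fun i => f i * (Function.update t j s i : ℂ) := by
  have e : (fun i => f i * (Function.update t j s i : ℂ)) =
      (fun i => f i * (t i : ℂ)) + Pi.single j (f j * (s - t j)) := by
    funext k
    by_cases hk : k = j
    · subst hk; simp; ring
    · simp [hk]
  rw [e]
  exact h.add (hasSum_pi_single j _).summable

/-! ### Diagonal blocks -/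

section diagonal

theorem timeTerm_diagonal (v : Idx n → ℂ) (t : Times) :
    timeTerm (Matrix.diagonal v) t =
      fun j => Matrix.diagonal fun i => v i ^ (2 * (j + 1)) * (t j : ℂ) := by
  funext j
  rw [timeTerm, Matrix.diagonal_pow, ← Matrix.diagonal_smul]
  congr 1; funext i; simp [mul_comm]

variable {v : Idx n → ℂ} {t : Times}
  (h : ∀ i, Summable fun j : ℕ => v i ^ (2 * (j + 1)) * (t j : ℂ))
include h

theorem summable_timeTerm_diagonal : Summable (timeTerm (Matrix.diagonal v) t) := by
  rw [timeTerm_diagonal]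
  exact (Pi.summable.mpr h).matrix_diagonal

theorem phi_diagonal (c : Idx n → ℂ) (x : ℝ) :
    phi (Matrix.diagonal v) c x t = fun i => c i * Complex.exp (theta (v i) x t) := by
  have h1 : exponent (Matrix.diagonal v) x t = Matrix.diagonal fun i => theta (v i) x t := by
    rw [exponent, timeTerm_diagonal, ← Matrix.diagonal_tsum, ← Matrix.diagonal_smul,
      ← Matrix.diagonal_smul, Matrix.diagonal_add]
    congr 1
    funext i
    simp only [Pi.smul_apply, smul_eq_mul, theta]
    rw [tsum_apply (Pi.summable.mpr h)]
    ring
  funext i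
  rw [phi, h1, Matrix.exp_diagonal, Matrix.mulVec_diagonal, Pi.coe_exp, Complex.exp_eq_exp_ℂ,
    mul_comm]

end diagonal

theorem tableA_diagonal {σ : ℝ} (k : Fin (n + 1) → ℂ) :
    tableA σ (Matrix.diagonal k) = Matrix.diagonal
      (Sum.elim k fun l => if σ = 1 then -conj (k l) else conj (k l)) := by
  have h1 : conjMat (Matrix.diagonal k) = Matrix.diagonal fun l => conj (k l) :=
    Matrix.diagonal_map (map_zero _)
  rw [tableA, h1, ← Matrix.fromBlocks_diagonal]
  split_ifs
  · rw [Matrix.diagonal_neg]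
  · rfl

/-- The times are real and the powers even, so the series at the conjugate point, with either sign,
is the conjugate of the given one. -/
theorem summable_tableA_diagonal {σ : ℝ} {k : Fin (n + 1) → ℂ} {t : Times}
    (h : ∀ l, Summable fun j : ℕ => k l ^ (2 * (j + 1)) * (t j : ℂ)) (i : Idx n) :
    Summable fun j : ℕ => (Sum.elim k fun l => if σ = 1 then -conj (k l) else conj (k l)) i ^
      (2 * (j + 1)) * (t j : ℂ) := by
  rcases i with l | l
  · exact h l
  · have h1 := (h l).map (starRingEnd ℂ) Complex.continuous_conj
    refine (summable_congr fun j => ?_).mp h1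
    simp only [Function.comp_apply, map_mul, map_pow, Complex.conj_ofReal, Sum.elim_inr]
    split_ifs
    · rw [pow_mul, pow_mul, neg_sq]
    · rfl

theorem phi_tableA_diagonal {σ : ℝ} {k : Fin (n + 1) → ℂ} {t : Times}
    (h : ∀ l, Summable fun j : ℕ => k l ^ (2 * (j + 1)) * (t j : ℂ)) (c d : Fin (n + 1) → ℂ)
    (x : ℝ) :
    phi (tableA σ (Matrix.diagonal k)) (Sum.elim c d) x t = phiDiag σ k c d x t := by
  rw [tableA_diagonal, phi_diagonal (summable_tableA_diagonal h)]
  funext i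
  rcases i with l | l <;> rfl

/-! ### Normally convergent series and their Taylor coefficients -/

/-- Normal convergence near a point of a series of functions which are holomorphic there. -/
def SumsNear (F : ℕ → ℂ → ℂ) (z : ℂ) : Prop :=
  ∃ u : ℕ → ℝ, Summable u ∧ ∀ᶠ w in nhds z, ∀ m, DifferentiableAt ℂ (F m) w ∧ ‖F m w‖ ≤ u m

theorem SumsNear.exists_ball {F : ℕ → ℂ → ℂ} {z : ℂ} (h : SumsNear F z) :
    ∃ u : ℕ → ℝ, Summable u ∧ ∃ r > 0, ∀ m, DifferentiableOn ℂ (F m) (Metric.ball z r) ∧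
      ∀ w ∈ Metric.ball z r, ‖F m w‖ ≤ u m := by
  obtain ⟨u, hu, h⟩ := h
  obtain ⟨r, hr, h⟩ := Metric.eventually_nhds_iff_ball.mp h
  exact ⟨u, hu, r, hr, fun m => ⟨fun w hw => (h w hw m).1.differentiableWithinAt,
    fun w hw => (h w hw m).2⟩⟩

theorem SumsNear.deriv {F : ℕ → ℂ → ℂ} {z : ℂ} (h : SumsNear F z) :
    SumsNear (fun m => deriv (F m)) z := by
  obtain ⟨u, hu, r, hr, h⟩ := h.exists_ball
  -- Cauchy's estimate is applied on discs of radius r/2 centred in the ball of radius r/2, which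
  -- stay inside the original ball.
  refine ⟨fun m => u m / (r / 2), hu.div_const _, ?_⟩
  filter_upwards [Metric.ball_mem_nhds z (half_pos hr)] with w hw m
  have hsub : Metric.closedBall w (r / 2) ⊆ Metric.ball z r := by
    refine Metric.closedBall_subset_ball' ?_
    rw [Metric.mem_ball] at hw
    linarith
  refine ⟨((h m).1.deriv Metric.isOpen_ball).differentiableAt
    (Metric.isOpen_ball.mem_nhds (hsub (Metric.mem_closedBall_self (half_pos hr).le))), ?_⟩
  refine Complex.norm_deriv_le_of_forall_mem_sphere_norm_le (half_pos hr) ?_ fun y hy =>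
    (h m).2 y (hsub (Metric.sphere_subset_closedBall hy))
  exact (((h m).1.mono hsub).diffContOnCl_ball subset_rfl)

theorem SumsNear.analyticAt_tsum {F : ℕ → ℂ → ℂ} {z : ℂ} (h : SumsNear F z) :
    AnalyticAt ℂ (fun w => ∑' m, F m w) z := by
  obtain ⟨u, hu, r, hr, h⟩ := h.exists_ball
  exact (Complex.differentiableOn_tsum_of_summable_norm hu (fun m => (h m).1) Metric.isOpen_ball
    fun m w hw => (h m).2 w hw).analyticAt (Metric.ball_mem_nhds z hr)

/-- Normal convergence passes to the derivatives, so Weierstrass' theorem on termwise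
differentiation can be iterated. -/
theorem SumsNear.hasSum_iteratedDeriv {F : ℕ → ℂ → ℂ} {z : ℂ} (h : SumsNear F z) (s : ℕ) :
    HasSum (fun m => iteratedDeriv s (F m) z) (iteratedDeriv s (fun w => ∑' m, F m w) z) := by
  induction s generalizing F with
  | zero =>
    obtain ⟨u, hu, r, hr, h⟩ := h.exists_ball
    simp only [iteratedDeriv_zero]
    exact (Summable.of_norm_bounded hu fun m => (h m).2 z (Metric.mem_ball_self hr)).hasSum
  | succ s ih =>
    have h1 := ih h.deriv
    simp only [iteratedDeriv_succ']
    have h2 : (fun w => ∑' m, _root_.deriv (F m) w) =ᶠ[nhds z]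
        _root_.deriv (fun w => ∑' m, F m w) := by
      obtain ⟨u, hu, r, hr, h⟩ := h.exists_ball
      filter_upwards [Metric.ball_mem_nhds z hr] with w hw
      exact (Complex.hasSum_deriv_of_summable_norm hu (fun m => (h m).1) Metric.isOpen_ball
        (fun m w hw => (h m).2 w hw) hw).tsum_eq
    rwa [h2.iteratedDeriv_eq s] at h1

theorem SumsNear.hasSum_taylor {F : ℕ → ℂ → ℂ} {z : ℂ} (h : SumsNear F z) :
    HasSum (fun m => taylor n (F m) z) (taylor n (fun w => ∑' m, F m w) z) :=
  Pi.hasSum.mpr fun s => (h.hasSum_iteratedDeriv s).div_const _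

theorem taylor_add {f g : ℂ → ℂ} {z : ℂ} (hf : AnalyticAt ℂ f z) (hg : AnalyticAt ℂ g z) :
    taylor n (fun w => f w + g w) z = taylor n f z + taylor n g z := by
  funext s
  simp only [taylor, Pi.add_apply]
  rw [iteratedDeriv_fun_add hf.contDiffAt hg.contDiffAt, add_div]

theorem taylor_const_mul (a : ℂ) {f : ℂ → ℂ} {z : ℂ} (hf : AnalyticAt ℂ f z) :
    taylor n (fun w => a * f w) z = a • taylor n f z := by
  funext s
  simp only [taylor, Pi.smul_apply, smul_eq_mul]
  rw [iteratedDeriv_const_mul a hf.contDiffAt, mul_div_assoc]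

theorem taylor_zero_fun (z : ℂ) : taylor n (fun _ => 0) z = 0 := by
  funext s
  simp [taylor]

theorem taylor_sub_pow (z : ℂ) (c : Fin (n + 1)) :
    taylor n (fun w => (w - z) ^ (c : ℕ)) z = Pi.single c 1 := by
  funext s
  simp only [taylor, iteratedDeriv_comp_sub_const (f := fun w : ℂ => w ^ (c : ℕ)),
    iteratedDeriv_pow, sub_self]
  rcases lt_trichotomy s c with h | h | h
  · have h1 : (c : ℕ) - s ≠ 0 := by have : (s : ℕ) < c := h; omega
    rw [zero_pow h1, Pi.single_eq_of_ne h.ne]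
    simp
  · subst h
    have : (Nat.factorial s : ℂ) ≠ 0 := Nat.cast_ne_zero.mpr (Nat.factorial_ne_zero _)
    simp [Nat.descFactorial_self, this]
  · rw [Nat.descFactorial_eq_zero_iff_lt.mpr h, Pi.single_eq_of_ne h.ne']
    simp

/-- In Leibniz' rule for w g(w) only two terms survive; after division by (s + 1)! the second is
g^{(s)}/s!, the contribution of the subdiagonal. -/
theorem jordan_mulVec_taylor (z : ℂ) {g : ℂ → ℂ} (hg : AnalyticAt ℂ g z) :
    (jordan n z).mulVec (taylor n g z) = taylor n (fun w => w * g w) z := by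
  funext s
  have hmul := fun m => iteratedDeriv_fun_mul (𝕜 := ℂ) (n := m) (x := z) (f := fun w => w) (g := g)
    contDiffAt_id hg.contDiffAt
  induction s using Fin.cases with
  | zero =>
    have h1 : ∀ j : Fin (n + 1), jordan n z 0 j = if 0 = j then z else 0 := by
      intro j
      simp [jordan]
    simp [Matrix.mulVec, dotProduct, taylor, h1]
  | succ s =>
    have h1 : ∀ j : Fin (n + 1), jordan n z s.succ j =
        (if s.succ = j then z else 0) + if s.castSucc = j then 1 else 0 := by
      intro j
      simp only [jordan, Matrix.of_apply, Fin.ext_iff, Fin.val_succ, Fin.val_castSucc,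
        Nat.add_right_cancel_iff]
      split_ifs <;> first | omega | simp
    have h2 : (Nat.factorial s : ℂ) ≠ 0 := Nat.cast_ne_zero.mpr (Nat.factorial_ne_zero _)
    have h3 : ((s : ℂ) + 1) ≠ 0 := Nat.cast_add_one_ne_zero _
    have h4 : iteratedDeriv ((s : ℕ) + 1) (fun w => w * g w) z =
        z * iteratedDeriv ((s : ℕ) + 1) g z + ((s : ℂ) + 1) * iteratedDeriv s g z := by
      rw [hmul, Finset.sum_range_succ', Finset.sum_range_succ', Finset.sum_eq_zero]
      · simp [iteratedDeriv_fun_id]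
        ring
      · intro i _
        simp [iteratedDeriv_fun_id]
    simp only [Matrix.mulVec, dotProduct, h1, add_mul, ite_mul, zero_mul, one_mul,
      Finset.sum_add_distrib, Finset.sum_ite_eq, Finset.mem_univ, if_true, taylor, Fin.val_succ,
      Fin.val_castSucc, h4, Nat.factorial_succ]
    push_cast
    field_simp

/-! ### Matrices acting on jets by multiplication, and Jordan blocks -/

/-- The Taylor coefficients of two functions at two points. -/
noncomputable def jets (n : ℕ) (z z' : ℂ) (g g' : ℂ → ℂ) : Idx n → ℂ :=
  Sum.elim (taylor n g z) (taylor n g' z')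

/-- The matrix `M` acts on Taylor coefficients as the multiplication by `h` and `h'`. -/
def ActsOnJets (z z' : ℂ) (M : Matrix (Idx n) (Idx n) ℂ) (h h' : ℂ → ℂ) : Prop :=
  ∀ g g', AnalyticAt ℂ g z → AnalyticAt ℂ g' z' →
    M.mulVec (jets n z z' g g') = jets n z z' (fun w => h w * g w) (fun w => h' w * g' w)

/-- Since the standard basis vectors are jets, the entries of a matrix can be read off from its
action on jets. -/
theorem exists_jets_eq_single (z z' : ℂ) (c : Idx n) : ∃ g g', AnalyticAt ℂ g z ∧
    AnalyticAt ℂ g' z' ∧ jets n z z' g g' = Pi.single c 1 := by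
  have han : ∀ (a : ℂ) (j : ℕ), AnalyticAt ℂ (fun w => (w - a) ^ j) a := fun a j => by fun_prop
  rcases c with c | c
  · refine ⟨_, _, han z c, analyticAt_const (v := 0), ?_⟩
    rw [jets, taylor_sub_pow, taylor_zero_fun]
    exact Sum.elim_single_zero c 1
  · refine ⟨_, _, analyticAt_const (v := 0), han z' c, ?_⟩
    rw [jets, taylor_sub_pow, taylor_zero_fun]
    exact Sum.elim_zero_single c 1

section acts

variable {z z' : ℂ}

theorem hasSum_jets {F F' : ℕ → ℂ → ℂ} (h : SumsNear F z) (h' : SumsNear F' z') :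
    HasSum (fun m => jets n z z' (F m) (F' m))
      (jets n z z' (fun w => ∑' m, F m w) (fun w => ∑' m, F' m w)) := by
  refine Pi.hasSum.mpr fun i => ?_
  rcases i with i | i
  · exact Pi.hasSum.mp h.hasSum_taylor i
  · exact Pi.hasSum.mp h'.hasSum_taylor i

theorem ActsOnJets.add {M N : Matrix (Idx n) (Idx n) ℂ} {h h' k k' : ℂ → ℂ}
    (hM : ActsOnJets z z' M h h') (hN : ActsOnJets z z' N k k') (hh : AnalyticAt ℂ h z)
    (hh' : AnalyticAt ℂ h' z') (hk : AnalyticAt ℂ k z) (hk' : AnalyticAt ℂ k' z') :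
    ActsOnJets z z' (M + N) (fun w => h w + k w) (fun w => h' w + k' w) := by
  intro g g' hg hg'
  rw [Matrix.add_mulVec, hM g g' hg hg', hN g g' hg hg']
  simp only [jets, add_mul]
  rw [taylor_add (hh.fun_mul hg) (hk.fun_mul hg), taylor_add (hh'.fun_mul hg') (hk'.fun_mul hg')]
  funext i
  rcases i with i | i <;> rfl

theorem ActsOnJets.smul {M : Matrix (Idx n) (Idx n) ℂ} {h h' : ℂ → ℂ}
    (hM : ActsOnJets z z' M h h') (hh : AnalyticAt ℂ h z) (hh' : AnalyticAt ℂ h' z') (a : ℂ) :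
    ActsOnJets z z' (a • M) (fun w => a * h w) (fun w => a * h' w) := by
  intro g g' hg hg'
  rw [Matrix.smul_mulVec, hM g g' hg hg']
  simp only [jets, mul_assoc]
  rw [taylor_const_mul a (hh.fun_mul hg), taylor_const_mul a (hh'.fun_mul hg')]
  funext i
  rcases i with i | i <;> rfl

theorem ActsOnJets.pow {M : Matrix (Idx n) (Idx n) ℂ} {h h' : ℂ → ℂ}
    (hM : ActsOnJets z z' M h h') (hh : AnalyticAt ℂ h z) (hh' : AnalyticAt ℂ h' z') (j : ℕ) :
    ActsOnJets z z' (M ^ j) (fun w => h w ^ j) (fun w => h' w ^ j) := by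
  induction j with
  | zero => intro g g' _ _; simp
  | succ j ih =>
    intro g g' hg hg'
    rw [pow_succ, ← Matrix.mulVec_mulVec, hM g g' hg hg', ih _ _ (hh.fun_mul hg) (hh'.fun_mul hg')]
    simp only [pow_succ, mul_assoc]

/-- Convergence of the matrix series is a conclusion: each column is the image of a basis vector,
hence of a jet, and the series of jets converges. -/
theorem ActsOnJets.tsum {M : ℕ → Matrix (Idx n) (Idx n) ℂ} {h h' : ℕ → ℂ → ℂ}
    (hM : ∀ j, ActsOnJets z z' (M j) (h j) (h' j))
    (hh : ∀ g, AnalyticAt ℂ g z → SumsNear (fun j w => h j w * g w) z)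
    (hh' : ∀ g, AnalyticAt ℂ g z' → SumsNear (fun j w => h' j w * g w) z') :
    Summable M ∧
      ActsOnJets z z' (∑' j, M j) (fun w => ∑' j, h j w) (fun w => ∑' j, h' j w) := by
  have hcol : ∀ g g', AnalyticAt ℂ g z → AnalyticAt ℂ g' z' →
      HasSum (fun j => (M j).mulVec (jets n z z' g g'))
        (jets n z z' (fun w => ∑' j, h j w * g w) (fun w => ∑' j, h' j w * g' w)) := by
    intro g g' hg hg'
    have h1 := hasSum_jets (n := n) (hh g hg) (hh' g' hg')
    rwa [← funext fun j => hM j g g' hg hg'] at h1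
  have hsum : Summable M := by
    refine Pi.summable.mpr fun i => Pi.summable.mpr fun c => ?_
    obtain ⟨g, g', hg, hg', e⟩ := exists_jets_eq_single (n := n) z z' c
    have h1 := Pi.summable.mp (hcol g g' hg hg').summable i
    rw [e] at h1
    simpa using h1
  refine ⟨hsum, fun g g' hg hg' => ?_⟩
  have h1 := hsum.hasSum.map
    ({ toFun := fun P => P.mulVec (jets n z z' g g'), map_zero' := Matrix.zero_mulVec _,
       map_add' := fun P Q => Matrix.add_mulVec P Q _ } :
      Matrix (Idx n) (Idx n) ℂ →+ (Idx n → ℂ))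
    (continuous_id.matrix_mulVec continuous_const)
  simp only [← tsum_mul_right]
  exact h1.unique (hcol g g' hg hg')

/-- Near z the terms are dominated by the exponential series at ‖h z‖ + 1. -/
theorem sumsNear_exp {h g : ℂ → ℂ} (hh : AnalyticAt ℂ h z) (hg : AnalyticAt ℂ g z) :
    SumsNear (fun m w => ((m.factorial : ℂ)⁻¹ * h w ^ m) * g w) z := by
  refine ⟨fun m => (‖h z‖ + 1) ^ m / m.factorial * (‖g z‖ + 1),
    (Real.summable_pow_div_factorial _).mul_right _, ?_⟩
  filter_upwards [hh.eventually_analyticAt, hg.eventually_analyticAt,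
    hh.continuousAt.norm.eventually_lt continuousAt_const (lt_add_one ‖h z‖),
    hg.continuousAt.norm.eventually_lt continuousAt_const (lt_add_one ‖g z‖)] with w h1 h2 h3 h4 m
  refine ⟨?_, ?_⟩
  · exact ((h1.differentiableAt.pow m).const_mul _).mul h2.differentiableAt
  · rw [norm_mul, norm_mul, norm_inv, norm_pow, Complex.norm_natCast, inv_mul_eq_div]
    gcongr

theorem ActsOnJets.exp {M : Matrix (Idx n) (Idx n) ℂ} {h h' : ℂ → ℂ}
    (hM : ActsOnJets z z' M h h') (hh : AnalyticAt ℂ h z) (hh' : AnalyticAt ℂ h' z') :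
    ActsOnJets z z' (NormedSpace.exp M) (fun w => Complex.exp (h w))
      (fun w => Complex.exp (h' w)) := by
  have h1 := (ActsOnJets.tsum
    (fun m => (hM.pow hh hh' m).smul (hh.fun_pow m) (hh'.fun_pow m) ((m.factorial : ℂ)⁻¹))
    (fun g hg => sumsNear_exp hh hg) (fun g hg => sumsNear_exp hh' hg)).2
  have h2 : ∀ a : ℂ, ∑' m : ℕ, (m.factorial : ℂ)⁻¹ * a ^ m = Complex.exp a := fun a => by
    rw [Complex.exp_eq_exp_ℂ, NormedSpace.exp_eq_tsum ℂ]; rfl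
  rw [(hasSum_matrix_exp M).tsum_eq] at h1
  simpa only [h2] using h1

end acts

section jordan

variable {σ : ℝ} {k : ℂ} {t : Times}

theorem tableA_jordan_actsOnJets (σ : ℝ) (k : ℂ) :
    ActsOnJets k (conj k) (tableA σ (jordan n k)) (fun w => w)
      (fun w => if σ = 1 then -w else w) := by
  intro g g' hg hg'
  have hc : conjMat (jordan n k) = jordan n (conj k) := by
    ext i j
    simp only [conjMat, jordan, Matrix.map_apply, Matrix.of_apply]
    split_ifs <;> simp
  rw [tableA, jets, Matrix.fromBlocks_mulVec, hc]
  simp only [Sum.elim_comp_inl, Sum.elim_comp_inr, Matrix.zero_mulVec, add_zero, zero_add]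
  rw [jordan_mulVec_taylor k hg, jets]
  congr 1
  split_ifs
  · have h1 := taylor_const_mul (n := n) (-1) (f := fun w => w * g' w)
      (analyticAt_id.fun_mul hg')
    rw [Matrix.neg_mulVec, jordan_mulVec_taylor _ hg', ← neg_one_smul ℂ, ← h1]
    simp
  · exact jordan_mulVec_taylor _ hg'

/-- The terms are compared with the series at ρ; the condition ‖h z‖ = ‖z‖ admits both h(w) = w and
h(w) = -w. -/
theorem sumsNear_powers {ρ : ℝ} {z : ℂ} (hz : ‖z‖ < ρ)
    (ht : Summable fun j : ℕ => ρ ^ (2 * (j + 1)) * t j) {h g : ℂ → ℂ}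
    (hh : AnalyticAt ℂ h z) (hhz : ‖h z‖ = ‖z‖) (hg : AnalyticAt ℂ g z) :
    SumsNear (fun j w => ((t j : ℂ) * h w ^ (2 * (j + 1))) * g w) z := by
  refine ⟨fun j => ‖ρ ^ (2 * (j + 1)) * t j‖ * (‖g z‖ + 1), ht.norm.mul_right _, ?_⟩
  filter_upwards [hh.eventually_analyticAt, hg.eventually_analyticAt,
    hh.continuousAt.norm.eventually_lt continuousAt_const (hhz.trans_lt hz),
    hg.continuousAt.norm.eventually_lt continuousAt_const (lt_add_one ‖g z‖)] with w h1 h2 h3 h4 m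
  refine ⟨((h1.differentiableAt.pow _).const_mul _).mul h2.differentiableAt, ?_⟩
  have hρ0 : 0 ≤ ρ := (norm_nonneg z).trans hz.le
  have hρ : |ρ| = ρ := abs_of_nonneg hρ0
  rw [norm_mul, norm_mul, norm_mul, norm_pow, norm_pow, Complex.norm_real, mul_comm ‖t m‖,
    Real.norm_eq_abs ρ, hρ]
  gcongr

variable (ht : ∃ ρ : ℝ, ‖k‖ < ρ ∧ Summable fun j : ℕ => ρ ^ (2 * (j + 1)) * t j)
include ht

theorem timeTerm_jordan_actsOnJets (σ : ℝ) :
    Summable (timeTerm (tableA σ (jordan n k)) t) ∧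
      ActsOnJets k (conj k) (∑' j, timeTerm (tableA σ (jordan n k)) t j)
        (fun w => ∑' j : ℕ, (t j : ℂ) * w ^ (2 * (j + 1)))
        (fun w => ∑' j : ℕ, (t j : ℂ) * (if σ = 1 then -w else w) ^ (2 * (j + 1))) := by
  obtain ⟨ρ, hρ, ht⟩ := ht
  have han : AnalyticAt ℂ (fun w : ℂ => if σ = 1 then -w else w) (conj k) := by
    split_ifs <;> fun_prop
  refine ActsOnJets.tsum (fun j => ((tableA_jordan_actsOnJets σ k).pow analyticAt_id han _).smul
    (by fun_prop) (han.fun_pow _) _) (fun g hg => sumsNear_powers hρ ht analyticAt_id rfl hg)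
    (fun g hg => sumsNear_powers (by rwa [Complex.norm_conj]) ht han ?_ hg)
  split_ifs <;> simp

theorem analyticAt_tsum_powers (σ : ℝ) :
    AnalyticAt ℂ (fun w => ∑' j : ℕ, (t j : ℂ) * w ^ (2 * (j + 1))) k ∧
    AnalyticAt ℂ (fun w => ∑' j : ℕ, (t j : ℂ) * (if σ = 1 then -w else w) ^ (2 * (j + 1)))
      (conj k) := by
  obtain ⟨ρ, hρ, ht⟩ := ht
  have h : ∀ (z : ℂ) (h : ℂ → ℂ), AnalyticAt ℂ h z → ‖z‖ < ρ → ‖h z‖ = ‖z‖ →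
      AnalyticAt ℂ (fun w => ∑' j : ℕ, (t j : ℂ) * h w ^ (2 * (j + 1))) z := by
    intro z h hh hz hhz
    have h1 := (sumsNear_powers hz ht hh hhz (analyticAt_const (v := 1))).analyticAt_tsum
    simpa only [mul_one] using h1
  refine ⟨h k _ analyticAt_id hρ rfl, h (conj k) _ ?_ (by rwa [Complex.norm_conj]) ?_⟩
  · split_ifs <;> fun_prop
  · split_ifs <;> simp

theorem analyticAt_theta (σ : ℝ) (x : ℝ) : AnalyticAt ℂ (fun w => theta w x t) k ∧
    AnalyticAt ℂ (fun w => theta (if σ = 1 then -w else w) x t) (conj k) := by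
  obtain ⟨h, h'⟩ := analyticAt_tsum_powers ht σ
  simp only [mul_comm (t _ : ℂ)] at h h'
  have han : AnalyticAt ℂ (fun w : ℂ => if σ = 1 then -w else w) (conj k) := by
    split_ifs <;> fun_prop
  exact ⟨((analyticAt_id.fun_mul analyticAt_const).fun_mul analyticAt_const).fun_add
      (analyticAt_const.fun_mul h),
    ((han.fun_mul analyticAt_const).fun_mul analyticAt_const).fun_add
      (analyticAt_const.fun_mul h')⟩

theorem exponent_jordan_actsOnJets (σ : ℝ) (x : ℝ) :
    ActsOnJets k (conj k) (exponent (tableA σ (jordan n k)) x t) (fun w => theta w x t)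
        (fun w => theta (if σ = 1 then -w else w) x t) := by
  have han : AnalyticAt ℂ (fun w : ℂ => if σ = 1 then -w else w) (conj k) := by
    split_ifs <;> fun_prop
  obtain ⟨ha, ha'⟩ := analyticAt_tsum_powers ht σ
  have h1 := ((tableA_jordan_actsOnJets (n := n) σ k).smul analyticAt_id han ((x : ℂ) / 2)).add
    ((timeTerm_jordan_actsOnJets ht σ).2.smul ha ha' (Complex.I / 2))
    (analyticAt_const.fun_mul analyticAt_id) (analyticAt_const.fun_mul han)
    (analyticAt_const.fun_mul ha) (analyticAt_const.fun_mul ha')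
  have e : ∀ w, theta w x t =
      (x : ℂ) / 2 * w + Complex.I / 2 * ∑' j : ℕ, (t j : ℂ) * w ^ (2 * (j + 1)) := fun w => by
    simp only [theta, mul_comm (t _ : ℂ)]
    ring
  simp only [e]
  exact h1

/-- The constant vector is the jet of (c, d), on which the exponential acts as multiplication by
e^θ. -/
theorem phi_tableA_jordan {c d : ℂ → ℂ} (hc : AnalyticAt ℂ c k) (hd : AnalyticAt ℂ d (conj k))
    (σ : ℝ) (x : ℝ) :
    phi (tableA σ (jordan n k)) (Sum.elim (taylor n c k) (taylor n d (conj k))) x t =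
      phiJordan n σ k c d x t := by
  obtain ⟨h1, h2⟩ := analyticAt_theta ht σ x
  have h := (exponent_jordan_actsOnJets (n := n) ht σ x).exp h1 h2 c d hc hd
  rw [phi, phiJordan]
  simp only [mul_comm (c _), mul_comm (d _)]
  exact h

end jordan

end AKNS

theorem theorem3 (n : ℕ) (σ δ : ℝ) (hσ : σ = 1 ∨ σ = -1) (hδ : δ = 1 ∨ δ = -1) :
    -- the general solution
    (∀ (A T : Matrix (AKNS.Idx n) (AKNS.Idx n) ℂ) (Cp Cm : AKNS.Idx n → ℂ),
      AKNS.Compatible σ δ A T → Cm = T.mulVec (AKNS.conjVec Cp) →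
      ∀ t : AKNS.Times, Summable (AKNS.timeTerm A t) →
        (∀ x, AKNS.psi A Cm x t = AKNS.reflected σ T (AKNS.phi A Cp) x t) ∧
        ∀ x, AKNS.tauF (AKNS.phi A Cp) (AKNS.psi A Cm) x t ≠ 0 →
          AKNS.SolvesNLSI σ δ (AKNS.wronskianQ (AKNS.phi A Cp) (AKNS.psi A Cm)) x t) ∧
    -- the table
    (∀ M : Matrix (Fin (n + 1)) (Fin (n + 1)) ℂ,
      AKNS.Compatible σ δ (AKNS.tableA σ M) (AKNS.tableT n σ δ)) ∧
    -- diagonal blocks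
    (∀ (k c d : Fin (n + 1) → ℂ) (t : AKNS.Times),
      (∀ l, Summable fun j : ℕ => k l ^ (2 * (j + 1)) * (t j : ℂ)) →
        (∀ x, AKNS.phi (AKNS.tableA σ (Matrix.diagonal k)) (Sum.elim c d) x t =
          AKNS.phiDiag σ k c d x t) ∧
        ∀ x, AKNS.tauF (AKNS.phiDiag σ k c d)
            (AKNS.reflected σ (AKNS.tableT n σ δ) (AKNS.phiDiag σ k c d)) x t ≠ 0 →
          AKNS.SolvesNLSI σ δ (AKNS.wronskianQ (AKNS.phiDiag σ k c d)
            (AKNS.reflected σ (AKNS.tableT n σ δ) (AKNS.phiDiag σ k c d))) x t) ∧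
    -- Jordan blocks
    (∀ (k : ℂ) (c d : ℂ → ℂ), AnalyticAt ℂ c k → AnalyticAt ℂ d (starRingEnd ℂ k) →
      ∀ t : AKNS.Times, (∃ ρ : ℝ, ‖k‖ < ρ ∧ Summable fun j : ℕ => ρ ^ (2 * (j + 1)) * t j) →
        (∀ x, AKNS.phi (AKNS.tableA σ (AKNS.jordan n k))
            (Sum.elim (AKNS.taylor n c k) (AKNS.taylor n d (starRingEnd ℂ k))) x t =
          AKNS.phiJordan n σ k c d x t) ∧
        ∀ x, AKNS.tauF (AKNS.phiJordan n σ k c d)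
            (AKNS.reflected σ (AKNS.tableT n σ δ) (AKNS.phiJordan n σ k c d)) x t ≠ 0 →
          AKNS.SolvesNLSI σ δ (AKNS.wronskianQ (AKNS.phiJordan n σ k c d)
            (AKNS.reflected σ (AKNS.tableT n σ δ) (AKNS.phiJordan n σ k c d))) x t) := by
  refine ⟨fun A T Cp Cm h hC t ht => ⟨fun x => ?_, fun x hf => ?_⟩,
    AKNS.tableA_tableT_compatible hσ hδ, fun k c d t ht => ⟨fun x => ?_, fun x hf => ?_⟩,
    fun k c d hc hd t ht => ⟨fun x => ?_, fun x hf => ?_⟩⟩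
  · rw [hC, h.psi_eq_reflected hσ ht]
  · subst hC
    exact h.solvesNLSI hσ hδ Cp ht hf
  · exact AKNS.phi_tableA_diagonal ht c d x
  · exact (AKNS.tableA_tableT_compatible hσ hδ (Matrix.diagonal k)).solvesNLSI_of_eq hσ hδ
      (Sum.elim c d)
      (G := fun t => ∀ l, Summable fun j : ℕ => k l ^ (2 * (j + 1)) * (t j : ℂ))
      (fun t ht j s l => AKNS.summable_update (ht l) j s)
      (fun t ht => by
        rw [AKNS.tableA_diagonal]
        exact AKNS.summable_timeTerm_diagonal (AKNS.summable_tableA_diagonal ht))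
      (fun t ht x => AKNS.phi_tableA_diagonal ht c d x) ht hf
  · exact AKNS.phi_tableA_jordan ht hc hd σ x
  · refine (AKNS.tableA_tableT_compatible hσ hδ (AKNS.jordan n k)).solvesNLSI_of_eq hσ hδ
      (Sum.elim (AKNS.taylor n c k) (AKNS.taylor n d (starRingEnd ℂ k)))
      (G := fun t => ∃ ρ : ℝ, ‖k‖ < ρ ∧ Summable fun j : ℕ => ρ ^ (2 * (j + 1)) * t j)
      ?_ (fun t ht => (AKNS.timeTerm_jordan_actsOnJets ht σ).1)
      (fun t ht x => AKNS.phi_tableA_jordan ht hc hd σ x) ht hf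
    rintro t ⟨ρ, hρ, ht⟩ j s
    -- The same ρ serves after one time is changed.
    refine ⟨ρ, hρ, (RCLike.summable_ofReal (𝕜 := ℂ)).mp ?_⟩
    have h1 := AKNS.summable_update (f := fun j => (ρ : ℂ) ^ (2 * (j + 1))) (t := t)
      (by exact_mod_cast (RCLike.summable_ofReal (𝕜 := ℂ)).mpr ht) j s
    exact_mod_cast h1
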